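/- Let $\alpha,\beta,v$ be real numbers with $|\alpha-\beta|<|v|<\alpha+\beta+2$ (so that $\alpha,\beta>-1$ and $v\neq 0$), and let $W$ be the Jacobi-type $2\times 2$ weight matrix on $(-1,1)$ $$W(x)=(1-x)^{\alpha}(1+x)^{\beta}\left(W_2\tfrac{(1-x)^2}{4}+W_1\tfrac{1-x}{2}+W_0\right),$$ $$W_2=\begin{pmatrix}\frac{v(v+2+\alpha+\beta)}{v+\alpha-\beta}&0\\0&\frac{v(-v+2+\alpha+\beta)}{v-\alpha+\beta}\end{pmatrix},\quad W_1=\begin{pmatrix}-(v+\alpha+\beta+2)&\alpha+\beta+2\\ \alpha+\beta+2&-(-v+\alpha+\beta+2)\end{pmatrix},\quad W_0=\begin{pmatrix}\alpha+1&-\alpha-1\\-\alpha-1&\alpha+1\end{pmatrix}.$$ A differential operator $D=\sum_{j=0}^m\partial^jF_j(x)$ with $F_j\in \mathrm{Mat}_2(\mathbb C[x])$ acts on the right on $P\in \mathrm{Mat}_2(\mathbb C[x])$ by $P\cdot D=\sum_j P^{(j)}F_j$, products satisfy $P\cdot(DE)=(P\cdot D)\cdot E$, and $D$ has order $m$ if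 $F_m\ne0$. A sequence of orthogonal polynomials for $W$ is a sequence $(Q_n)_{n\ge0}$ in $\mathrm{Mat}_2(\mathbb C[x])$ with $Q_n$ of degree $n$ with nonsingular leading coefficient and $\int_{-1}^1Q_n(x)W(x)Q_m(x)^*\,dx=0$ for $n\ne m$. Let $\mathcal D(W)$ be the algebra of all such differential operators $D$ for which, for every sequence $(Q_n)$ of orthogonal polynomials for $W$ and every $n\ge0$, there is $\Lambda_n\in\mathrm{Mat}_2(\mathbb C)$ with $Q_n\cdot D=\Lambda_nQ_n$. Put $$\mathcal V=\partial\begin{pmatrix}x+\frac{\beta-\alpha}{v}&1+\frac{\beta-\alpha}{v}\\1+\frac{\alpha-\beta}{v}&x+\frac{\alpha-\beta}{v}\end{pmatrix}+\begin{pmatrix}\frac{v+2+\alpha+\beta}{2}&0\\0&\frac{-v+2+\alpha+\beta}{2}\end{pmatrix},$$ $$\mathcal N=\partial\begin{pmatrix}-x+\frac{\beta-\alpha}{v}&1+\frac{\beta-\alpha}{v}\\1+\frac{\alpha-\beta}{v}&-x+\frac{\alpha-\beta}{v}\end{pmatrix}+\begin{pmatrix}-\frac{-v+4+\alpha+\beta}{2}&0\\0&-\frac{\alpha+\beta+v+4}{2}\end{pmatrix},$$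 and let $D_1=\mathcal N E_{11}\mathcal V$, $D_2=\mathcal N E_{12}\mathcal V$, $D_3=\mathcal N E_{21}\mathcal V$, $D_4=\mathcal N E_{22}\mathcal V$, where $E_{ij}$ are the $2\times2$ matrix units. Then the following hold. (1) Each $D_i$ has order $2$, and explicitly $$\begin{aligned}D_1={}&\partial^2\begin{pmatrix}-x^2+\frac{(\alpha-\beta)^2}{v^2}&\frac{(vx+\alpha-\beta)(-v+\alpha-\beta)}{v^2}\\ \frac{(vx-\alpha+\beta)(v-\beta+\alpha)}{v^2}&1-\frac{(\alpha-\beta)^2}{v^2}\end{pmatrix}\\&+\partial\begin{pmatrix}-x(\alpha+\beta+4)-\frac{(v-2)(\alpha-\beta)}{v}&\frac{(-v+\alpha-\beta)(\alpha+\beta-v+6)}{2v}\\ \frac{(v-\beta+\alpha)(v+2+\alpha+\beta)}{2v}&0\end{pmatrix}+\begin{pmatrix}-\frac{(-v+4+\alpha+\beta)(v+2+\alpha+\beta)}{4}&0\\0&0\end{pmatrix},\end{aligned}$$ $$\begin{aligned}D_2={}&\partial^2\begin{pmatrix}\frac{(vx+\alpha-\beta)(-v+\beta-\alpha)}{v^2}&-\frac{(vx+\alpha-\beta)^2}{v^2}\\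 \frac{(v-\beta+\alpha)^2}{v^2}&\frac{(vx+\alpha-\beta)(v-\beta+\alpha)}{v^2}\end{pmatrix}\\&+\partial\begin{pmatrix}\frac{(-v+\beta-\alpha)(\alpha+\beta-v+6)}{2v}&-\frac{(-v+4+\alpha+\beta)(vx+\alpha-\beta)}{v}\\0&\frac{(v-\beta+\alpha)(-v+2+\alpha+\beta)}{2v}\end{pmatrix}+\begin{pmatrix}0&-\frac{(-v+4+\alpha+\beta)(-v+2+\alpha+\beta)}{4}\\0&0\end{pmatrix},\end{aligned}$$ $$\begin{aligned}D_3={}&\partial^2\begin{pmatrix}\frac{(-vx+\alpha-\beta)(-v+\alpha-\beta)}{v^2}&\frac{(-v+\alpha-\beta)^2}{v^2}\\-\frac{(-vx+\alpha-\beta)^2}{v^2}&\frac{(-vx+\alpha-\beta)(v-\alpha+\beta)}{v^2}\end{pmatrix}\\&+\partial\begin{pmatrix}-\frac{(v+2+\alpha+\beta)(-v+\alpha-\beta)}{2v}&0\\ \frac{(\alpha+\beta+v+4)(-vx+\alpha-\beta)}{v}&\frac{(\alpha+\beta+v+6)(-v+\alpha-\beta)}{2v}\end{pmatrix}+\begin{pmatrix}0&0\\-\frac{(\alpha+\beta+v+4)(v+2+\alpha+\beta)}{4}&0\end{pmatrix},\end{aligned}$$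 $$\begin{aligned}D_4={}&\partial^2\begin{pmatrix}1-\frac{(\alpha-\beta)^2}{v^2}&\frac{(vx+\alpha-\beta)(v+\beta-\alpha)}{v^2}\\ \frac{(-vx+\alpha-\beta)(v-\beta+\alpha)}{v^2}&-x^2+\frac{(\alpha-\beta)^2}{v^2}\end{pmatrix}\\&+\partial\begin{pmatrix}0&\frac{(v-\alpha+\beta)(-v+2+\alpha+\beta)}{2v}\\-\frac{(v-\beta+\alpha)(\alpha+\beta+v+6)}{2v}&-x(\alpha+\beta+4)-\frac{(v+2)(\alpha-\beta)}{v}\end{pmatrix}+\begin{pmatrix}0&0\\0&-\frac{(\alpha+\beta+v+4)(-v+2+\alpha+\beta)}{4}\end{pmatrix}.\end{aligned}$$ (2) $\mathcal D(W)$ is generated, as a $\mathbb C$-algebra, by $\{I,D_1,D_2,D_3,D_4\}$. (3) Every nonzero operator in $\mathcal D(W)$ has even order. -/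

import Mathlib

open Polynomial MeasureTheory

noncomputable section

/-- Polynomials in `x` with complex matrix coefficients, as matrices of complex polynomials. -/
abbrev MatPoly (n : Type) : Type := Matrix n n ℂ[X]

/-- Operators on matrix polynomials that act on the *right*: the opposite algebra of the
endomorphism algebra, so that `P · (D * E) = (P · D) · E`. -/
abbrev RightOp (n : Type) : Type := (Module.End ℂ (MatPoly n))ᵐᵒᵖ

/-- The right action `P · D`. -/
def actRight {n : Type} (P : MatPoly n) (D : RightOp n) : MatPoly n := D.unop P

/-- `∂ = d/dx`, acting entrywise. -/
def del (n : Type) : RightOp n :=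
  MulOpposite.op (LinearMap.mapMatrix (Polynomial.derivative : ℂ[X] →ₗ[ℂ] ℂ[X]))

/-- The operator of order zero `P ↦ P F`. -/
def mulBy {n : Type} [Fintype n] [DecidableEq n] (F : MatPoly n) : RightOp n :=
  MulOpposite.op (LinearMap.mulRight ℂ F)

/-- The differential operator `∑_{j ≤ m} ∂ ^ j F_j`, that is
`P ↦ ∑_{j ≤ m} P^{(j)} F_j`. -/
def diffOp {n : Type} [Fintype n] [DecidableEq n] (m : ℕ) (F : ℕ → MatPoly n) : RightOp n :=
  ∑ j ∈ Finset.range (m + 1), del n ^ j * mulBy (F j)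

/-- `Mat_N(Ω[x])`: all matrix differential operators with polynomial coefficients. -/
def MatOmega (n : Type) [Fintype n] [DecidableEq n] : Set (RightOp n) :=
  {D | ∃ (m : ℕ) (F : ℕ → MatPoly n), D = diffOp m F}

/-- `D` is a differential operator of order exactly `m`. -/
def HasOrder {n : Type} [Fintype n] [DecidableEq n] (D : RightOp n) (m : ℕ) : Prop :=
  ∃ F : ℕ → MatPoly n, D = diffOp m F ∧ F m ≠ 0

/-- The value `P(x)` of a matrix polynomial at a real point. -/
def evalAt {n : Type} (P : MatPoly n) (x : ℝ) : Matrix n n ℂ :=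
  P.map (fun p => p.eval (x : ℂ))

/-- `⟨P, Q⟩_W = ∫ P(x) W(x) Q(x)^* dx` over `s`, entry by entry. -/
def matInner {n : Type} [Fintype n] (s : Set ℝ) (W : ℝ → Matrix n n ℂ) (P Q : MatPoly n) :
    Matrix n n ℂ :=
  Matrix.of fun i j => ∫ x in s, (evalAt P x * W x * (evalAt Q x).conjTranspose) i j

/-- A sequence of matrix orthogonal polynomials for the weight `W` on `s`: `Q k` has degree `k`
with nonsingular leading coefficient, and the `Q k` are pairwise orthogonal. -/
structure IsOrthogonalSeq {n : Type} [Fintype n] [DecidableEq n] (s : Set ℝ)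
    (W : ℝ → Matrix n n ℂ) (Q : ℕ → MatPoly n) : Prop where
  degree_le : ∀ k i j, (Q k i j).degree ≤ k
  leading : ∀ k, IsUnit ((Q k).map (fun p => p.coeff k))
  orthogonal : ∀ k l, k ≠ l → matInner s W (Q k) (Q l) = 0

/-- `𝒟(W)`: the differential operators with polynomial coefficients that have the orthogonal
polynomials of `W` as eigenfunctions, `Q k · D = Λ_k Q k` with constant matrices `Λ_k`. -/
def opAlgebra {n : Type} [Fintype n] [DecidableEq n] (s : Set ℝ) (W : ℝ → Matrix n n ℂ) :
    Set (RightOp n) :=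
  {D | D ∈ MatOmega n ∧ ∀ Q, IsOrthogonalSeq s W Q →
    ∀ k, ∃ L : Matrix n n ℂ, actRight (Q k) D = L.map Polynomial.C * Q k}

/-- The Jacobi-type weight, to be used on `(-1, 1)`. -/
def jacobiWeight (α β v : ℝ) (x : ℝ) : Matrix (Fin 2) (Fin 2) ℂ :=
  (((1 - x) ^ α * (1 + x) ^ β) •
    (((1 - x) ^ 2 / 4) •
        !![v * (v + 2 + α + β) / (v + α - β), 0;
           0, v * (-v + 2 + α + β) / (v - α + β)]
      + ((1 - x) / 2) •
        !![-(v + α + β + 2), α + β + 2;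
           α + β + 2, -(-v + α + β + 2)]
      + !![α + 1, -α - 1;
           -α - 1, α + 1])).map Complex.ofReal

/-- A real number as a constant complex polynomial. -/
def rc (r : ℝ) : ℂ[X] := Polynomial.C (r : ℂ)

/-- The first-order operator `𝒱`. -/
def jacobiV (α β v : ℝ) : RightOp (Fin 2) :=
  del (Fin 2) * mulBy
      !![X + rc ((β - α) / v), rc (1 + (β - α) / v);
         rc (1 + (α - β) / v), X + rc ((α - β) / v)]
    + mulBy
      !![rc ((v + 2 + α + β) / 2), 0;
         0, rc ((-v + 2 + α + β) / 2)]

/-- The first-order operator `𝒩`. -/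
def jacobiN (α β v : ℝ) : RightOp (Fin 2) :=
  del (Fin 2) * mulBy
      !![-X + rc ((β - α) / v), rc (1 + (β - α) / v);
         rc (1 + (α - β) / v), -X + rc ((α - β) / v)]
    + mulBy
      !![rc (-(-v + 4 + α + β) / 2), 0;
         0, rc (-(α + β + v + 4) / 2)]

/-- `𝒩 E 𝒱` with `E` the matrix unit at position `(i, j)`. -/
def jacobiD (α β v : ℝ) (i j : Fin 2) : RightOp (Fin 2) :=
  jacobiN α β v * mulBy (Matrix.single i j 1) * jacobiV α β v

end

open Polynomial MeasureTheory

set_option linter.unusedSectionVars false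

/-! Write δ for the scalar Jacobi operator with parameters (α + 1, β + 1), q = 1 - x², and P_m for
its eigenpolynomials. The proof is a Darboux transformation: `jacobiV_mul_jacobiN` gives 𝒱𝒩 = δ - T
with T constant diagonal. The leading coefficients of 𝒱 and 𝒩 are x + S and -x + S with S² = 1, so
their product is q.

The weight factors as the scalar density times n K nᵀ, with n the leading coefficient of 𝒩 and K a
constant diagonal matrix. One integration by parts then makes 𝒱 and -𝒩 adjoint between W and qK
(`jacobiFunctional_adjoint`). Hence 𝒩 sends the orthogonal polynomials of W to constant multiples of
P_m, and 𝒱 sends P_m back. Each 𝒩E𝒱 with E constant therefore lies in 𝒟(W).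

Conversely, for D in 𝒟(W) the operator 𝒱D𝒩 has every P_m as eigenfunction, so it commutes with δ
(`JacobiParams.commute_of_mem`). Comparing leading terms, an operator of order k commuting with δ
has leading coefficient G with 2qG' = kq'G. Thus G = q^(k/2) M with M constant when k is even, and G
= 0 when k is odd (`HasTop.leading_of_commute`). Since 𝒱 and 𝒩 have leading coefficients that are
invertible up to q, D has even order, and in order 2(l + 1) its leading coefficient is that of
𝒩Mδ^l𝒱. Subtracting this operator lowers the order, so induction reduces everything to order zero
(`JacobiParams.mem_adjoin`).

Two facts finish the argument. The factorization rewrites 𝒩Mδ^l𝒱 through products of the D_i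
(`JacobiParams.generator_mem`). In order zero only scalars survive
(`JacobiParams.eq_smul_one_of_mulBy_mem`). -/

noncomputable section

/-! ### Matrix differential operators: order, leading coefficient, commutators. -/

section Operators

variable {n : Type}

/-- The entrywise derivative of a matrix polynomial. -/
abbrev matDeriv (F : MatPoly n) : MatPoly n := F.map derivative

lemma actRight_add (P : MatPoly n) (D E : RightOp n) :
    actRight P (D + E) = actRight P D + actRight P E := rfl

lemma actRight_sub (P : MatPoly n) (D E : RightOp n) :
    actRight P (D - E) = actRight P D - actRight P E := rfl

lemma actRight_zero (P : MatPoly n) : actRight P (0 : RightOp n) = 0 := rfl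

lemma actRight_one (P : MatPoly n) : actRight P (1 : RightOp n) = P := rfl

lemma actRight_smul (P : MatPoly n) (a : ℂ) (D : RightOp n) :
    actRight P (a • D) = a • actRight P D := rfl

lemma actRight_mul (P : MatPoly n) (D E : RightOp n) :
    actRight P (D * E) = actRight (actRight P D) E := rfl

lemma add_actRight (P Q : MatPoly n) (D : RightOp n) :
    actRight (P + Q) D = actRight P D + actRight Q D := map_add D.unop P Q

lemma sub_actRight (P Q : MatPoly n) (D : RightOp n) :
    actRight (P - Q) D = actRight P D - actRight Q D := map_sub D.unop P Q

lemma zero_actRight (D : RightOp n) : actRight 0 D = 0 := map_zero D.unop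

lemma rightOp_ext {D E : RightOp n} (h : ∀ P, actRight P D = actRight P E) : D = E :=
  MulOpposite.unop_injective (LinearMap.ext h)

lemma actRight_del (P : MatPoly n) : actRight P (del n) = matDeriv P := rfl

variable [Fintype n] [DecidableEq n]

lemma actRight_mulBy (P F : MatPoly n) : actRight P (mulBy F) = P * F := rfl

lemma mulBy_mul (F G : MatPoly n) : mulBy F * mulBy G = mulBy (F * G) :=
  rightOp_ext fun P => by simp [actRight_mul, actRight_mulBy, mul_assoc]

lemma mulBy_one : mulBy (1 : MatPoly n) = 1 :=
  rightOp_ext fun P => by simp [actRight_one, actRight_mulBy]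

lemma mulBy_add (F G : MatPoly n) : mulBy (F + G) = mulBy F + mulBy G :=
  rightOp_ext fun P => by simp [actRight_add, actRight_mulBy, mul_add]

lemma mulBy_sub (F G : MatPoly n) : mulBy (F - G) = mulBy F - mulBy G :=
  rightOp_ext fun P => by simp [actRight_sub, actRight_mulBy, mul_sub]

lemma mulBy_zero : mulBy (0 : MatPoly n) = 0 :=
  rightOp_ext fun P => by simp [actRight_zero, actRight_mulBy]

lemma mulBy_smul (a : ℂ) (F : MatPoly n) : mulBy (a • F) = a • mulBy F :=
  rightOp_ext fun P => by simp [actRight_smul, actRight_mulBy]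

lemma matDeriv_mul (P F : MatPoly n) :
    matDeriv (P * F) = matDeriv P * F + P * matDeriv F := by
  ext1 i j
  simp [Matrix.mul_apply, Finset.sum_add_distrib]

lemma mulBy_mul_del (F : MatPoly n) :
    mulBy F * del n = del n * mulBy F + mulBy (matDeriv F) :=
  rightOp_ext fun P => by
    simp only [actRight_mul, actRight_mulBy, actRight_add, actRight_del, matDeriv_mul]

/-- The differential operators of order less than `k`. -/
def orderLT (n : Type) [Fintype n] [DecidableEq n] (k : ℕ) : Submodule ℂ (RightOp n) :=
  Submodule.span ℂ {D | ∃ j < k, ∃ F : MatPoly n, D = del n ^ j * mulBy F}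

lemma monomial_mem {j k : ℕ} (h : j < k) (F : MatPoly n) :
    del n ^ j * mulBy F ∈ orderLT n k :=
  Submodule.subset_span ⟨j, h, F, rfl⟩

lemma mulBy_mem {k : ℕ} (h : 0 < k) (F : MatPoly n) : mulBy F ∈ orderLT n k := by
  simpa using monomial_mem h F

lemma orderLT_mono {k l : ℕ} (h : k ≤ l) : orderLT n k ≤ orderLT n l :=
  Submodule.span_mono fun _ ⟨j, hj, F, hF⟩ => ⟨j, hj.trans_le h, F, hF⟩

/-- A scalar can be absorbed into the coefficient of a monomial, so the span is already the additive
closure and no scalar case is needed. -/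
lemma orderLT_induction {k : ℕ} {p : RightOp n → Prop}
    (mono : ∀ j < k, ∀ F : MatPoly n, p (del n ^ j * mulBy F)) (zero : p 0)
    (add : ∀ D E, p D → p E → p (D + E)) {D : RightOp n} (hD : D ∈ orderLT n k) : p D := by
  refine Submodule.closure_induction (p := fun D _ => p D) zero
    (fun D E _ _ => add D E) ?_ hD
  rintro a D ⟨j, hj, F, rfl⟩
  have := mono j hj (a • F)
  rwa [mulBy_smul, mul_smul_comm] at this

lemma orderLT_zero {D : RightOp n} (hD : D ∈ orderLT n 0) : D = 0 :=
  orderLT_induction (p := fun D => D = 0) (fun _ hj => absurd hj (Nat.not_lt_zero _)) rfl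
    (by rintro D E rfl rfl; simp) hD

lemma mul_mulBy_mem {k : ℕ} {D : RightOp n} (hD : D ∈ orderLT n k) (F : MatPoly n) :
    D * mulBy F ∈ orderLT n k := by
  refine orderLT_induction (p := fun D => D * mulBy F ∈ orderLT n k) ?_ (by simp) ?_ hD
  · intro j hj G
    rw [mul_assoc, mulBy_mul]
    exact monomial_mem hj _
  · intro D E h1 h2
    rw [add_mul]
    exact add_mem h1 h2

lemma del_pow_mul_mem {k : ℕ} (i : ℕ) {D : RightOp n} (hD : D ∈ orderLT n k) :
    del n ^ i * D ∈ orderLT n (i + k) := by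
  refine orderLT_induction (p := fun D => del n ^ i * D ∈ orderLT n (i + k)) ?_ (by simp) ?_ hD
  · intro j hj G
    rw [← mul_assoc, ← pow_add]
    exact monomial_mem (by omega) _
  · intro D E h1 h2
    rw [mul_add]
    exact add_mem h1 h2

lemma mul_del_mem {k : ℕ} {D : RightOp n} (hD : D ∈ orderLT n k) :
    D * del n ∈ orderLT n (k + 1) := by
  refine orderLT_induction (p := fun D => D * del n ∈ orderLT n (k + 1)) ?_ (by simp) ?_ hD
  · intro j hj G
    rw [mul_assoc, mulBy_mul_del, mul_add, ← mul_assoc, ← pow_succ]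
    exact add_mem (monomial_mem (by omega) _) (monomial_mem (by omega) _)
  · intro D E h1 h2
    rw [add_mul]
    exact add_mem h1 h2

lemma mul_del_pow_mem {k : ℕ} (i : ℕ) {D : RightOp n} (hD : D ∈ orderLT n k) :
    D * del n ^ i ∈ orderLT n (k + i) := by
  induction i with
  | zero => simpa using hD
  | succ i ih =>
    rw [pow_succ, ← mul_assoc]
    exact mul_del_mem ih

/-- Orders add. As `orderLT` is strict, order at most k is written `k + 1`, and only one of the two
bounds in the product is strict. -/
lemma mul_mem_orderLT {k l : ℕ} {D E : RightOp n} (hD : D ∈ orderLT n (k + 1))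
    (hE : E ∈ orderLT n l) : D * E ∈ orderLT n (k + l) := by
  refine orderLT_induction (p := fun E => D * E ∈ orderLT n (k + l)) ?_ (by simp) ?_ hE
  · intro j hj G
    rw [← mul_assoc]
    exact mul_mulBy_mem (orderLT_mono (by omega) (mul_del_pow_mem j hD)) G
  · intro D E h1 h2
    rw [mul_add]
    exact add_mem h1 h2

lemma orderLT_mul_mem {k l : ℕ} {D E : RightOp n} (hD : D ∈ orderLT n k)
    (hE : E ∈ orderLT n (l + 1)) : D * E ∈ orderLT n (k + l) := by
  cases k with
  | zero => simp [orderLT_zero hD]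
  | succ k => exact orderLT_mono (by omega) (mul_mem_orderLT hD hE)

lemma exists_eq_sum {k : ℕ} {D : RightOp n} (hD : D ∈ orderLT n k) :
    ∃ F : ℕ → MatPoly n, D = ∑ j ∈ Finset.range k, del n ^ j * mulBy (F j) := by
  refine orderLT_induction
    (p := fun D => ∃ F : ℕ → MatPoly n, D = ∑ i ∈ Finset.range k, del n ^ i * mulBy (F i))
    ?_ ⟨0, by simp [mulBy_zero]⟩ ?_ hD
  · intro j hj G
    refine ⟨Pi.single j G, ?_⟩
    rw [Finset.sum_eq_single_of_mem j (Finset.mem_range.2 hj)]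
    · simp
    · intro i _ hi
      simp [Pi.single_eq_of_ne hi, mulBy_zero]
  · rintro D E ⟨F, rfl⟩ ⟨G, rfl⟩
    exact ⟨F + G, by simp [mulBy_add, mul_add, Finset.sum_add_distrib]⟩

lemma diffOp_mem (m : ℕ) (F : ℕ → MatPoly n) : diffOp m F ∈ orderLT n (m + 1) :=
  sum_mem fun _ hj => monomial_mem (Finset.mem_range.1 hj) _

lemma mem_matOmega_iff {D : RightOp n} : D ∈ MatOmega n ↔ ∃ k, D ∈ orderLT n k := by
  constructor
  · rintro ⟨m, F, rfl⟩
    exact ⟨_, diffOp_mem m F⟩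
  · rintro ⟨k, hk⟩
    obtain ⟨F, hF⟩ := exists_eq_sum (orderLT_mono (Nat.le_succ k) hk)
    exact ⟨k, F, hF⟩

/-- `D = ∂ ^ m G + (terms of order less than m)`. -/
def HasTop (D : RightOp n) (m : ℕ) (G : MatPoly n) : Prop :=
  D - del n ^ m * mulBy G ∈ orderLT n m

lemma hasTop_diffOp (m : ℕ) (F : ℕ → MatPoly n) : HasTop (diffOp m F) m (F m) := by
  rw [HasTop, diffOp, Finset.sum_range_succ, add_sub_cancel_right]
  exact sum_mem fun j hj => monomial_mem (Finset.mem_range.1 hj) _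

lemma HasTop.mem {D : RightOp n} {m : ℕ} {G : MatPoly n} (h : HasTop D m G) :
    D ∈ orderLT n (m + 1) := by
  have := add_mem (orderLT_mono (Nat.le_succ m) h) (monomial_mem (Nat.lt_succ_self m) G)
  simpa using this

lemma exists_hasTop {D : RightOp n} {m : ℕ} (hD : D ∈ orderLT n (m + 1)) :
    ∃ G, HasTop D m G := by
  obtain ⟨F, hF⟩ := exists_eq_sum hD
  exact ⟨F m, by rw [hF]; exact hasTop_diffOp m F⟩

lemma HasTop.sub {D E : RightOp n} {m : ℕ} {G H : MatPoly n} (hD : HasTop D m G)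
    (hE : HasTop E m H) : HasTop (D - E) m (G - H) := by
  have := sub_mem hD hE
  rw [HasTop, mulBy_sub, mul_sub]
  convert this using 1
  abel

lemma HasTop.mem_of_zero {D : RightOp n} {m : ℕ} (h : HasTop D m 0) : D ∈ orderLT n m := by
  simpa [HasTop, mulBy_zero] using h

lemma mulBy_mul_del_pow_sub_mem (G : MatPoly n) (k : ℕ) :
    mulBy G * del n ^ k - del n ^ k * mulBy G ∈ orderLT n k := by
  induction k with
  | zero => simp
  | succ k ih =>
    have h1 := mul_del_mem ih
    have h2 : del n ^ k * mulBy (matDeriv G) ∈ orderLT n (k + 1) :=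
      monomial_mem (Nat.lt_succ_self k) _
    convert add_mem h1 h2 using 1
    rw [sub_mul, mul_assoc (del n ^ k), mulBy_mul_del, pow_succ]
    noncomm_ring

/-- Moving G past ∂^k produces only derivatives of G at lower order, so leading coefficients
multiply. -/
lemma HasTop.mul {D E : RightOp n} {m k : ℕ} {G H : MatPoly n} (hD : HasTop D m G)
    (hE : HasTop E k H) : HasTop (D * E) (m + k) (G * H) := by
  have h1 := mul_mem_orderLT hD.mem hE
  have h2 := orderLT_mul_mem hD (monomial_mem (Nat.lt_succ_self k) H)
  have h3 := mul_mulBy_mem (del_pow_mul_mem m (mulBy_mul_del_pow_sub_mem G k)) H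
  rw [HasTop]
  convert add_mem (add_mem h1 h2) h3 using 1
  rw [← mulBy_mul, pow_add]
  simp only [mul_sub, sub_mul, mul_assoc]
  abel

lemma actRight_del_pow (P : MatPoly n) (k : ℕ) :
    actRight P (del n ^ k) = P.map (derivative^[k]) := by
  induction k with
  | zero => simp [actRight_one]
  | succ k ih =>
    rw [pow_succ, actRight_mul, ih, actRight_del, matDeriv, Matrix.map_map,
      Function.iterate_succ']

lemma actRight_monomial (p : ℂ[X]) (k : ℕ) (G : MatPoly n) :
    actRight (p • (1 : MatPoly n)) (del n ^ k * mulBy G) = derivative^[k] p • G := by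
  have : (p • (1 : MatPoly n)).map (derivative^[k]) = derivative^[k] p • (1 : MatPoly n) := by
    ext1 i j
    by_cases h : i = j <;> simp [h]
  rw [actRight_mul, actRight_del_pow, this, actRight_mulBy]
  simp

lemma eval_actRight_of_mem {D : RightOp n} {k : ℕ} (hD : D ∈ orderLT n k) (a : ℂ) (i j : n) :
    (actRight (((X - C a) ^ k) • (1 : MatPoly n)) D i j).eval a = 0 := by
  refine orderLT_induction
    (p := fun D => (actRight (((X - C a) ^ k) • (1 : MatPoly n)) D i j).eval a = 0) ?_ ?_ ?_ hD
  · intro l hl G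
    rw [actRight_monomial, iterate_derivative_X_sub_pow]
    simp [Nat.sub_ne_zero_of_lt hl]
  · simp [actRight_zero]
  · intro D E h1 h2
    simp [actRight_add, h1, h2]

/-- Test on (x - a)^m at x = a: lower orders contribute nothing, while ∂^m G contributes m! G(a).
This makes leading coefficients unique. -/
lemma HasTop.eq_zero {D : RightOp n} {m : ℕ} {G : MatPoly n} (h : HasTop D m G)
    (hD : D ∈ orderLT n m) : G = 0 := by
  have h1 : del n ^ m * mulBy G ∈ orderLT n m := by
    simpa using sub_mem hD h
  ext1 i j
  refine Polynomial.funext fun a => ?_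
  have h2 := eval_actRight_of_mem h1 a i j
  rw [actRight_monomial, iterate_derivative_X_sub_pow] at h2
  simpa [Nat.factorial_ne_zero, Nat.descFactorial_self] using h2

/-- Compatibility with left multiplication by constant matrices. -/
def LeftLinear (D : RightOp n) : Prop :=
  ∀ (L : Matrix n n ℂ) (P : MatPoly n),
    actRight (L.map C * P) D = L.map C * actRight P D

lemma leftLinear_mulBy (F : MatPoly n) : LeftLinear (mulBy F) := fun L P => by
  simp [actRight_mulBy, mul_assoc]

lemma leftLinear_del : LeftLinear (del n) := fun L P => by
  have : matDeriv (L.map C) = 0 := by ext1; simp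
  rw [actRight_del, actRight_del, matDeriv_mul, this]
  simp

lemma LeftLinear.mul {D E : RightOp n} (hD : LeftLinear D) (hE : LeftLinear E) :
    LeftLinear (D * E) := fun L P => by
  rw [actRight_mul, hD, hE, actRight_mul]

lemma LeftLinear.add {D E : RightOp n} (hD : LeftLinear D) (hE : LeftLinear E) :
    LeftLinear (D + E) := fun L P => by
  rw [actRight_add, hD, hE, actRight_add, mul_add]

lemma leftLinear_of_mem {D : RightOp n} {k : ℕ} (hD : D ∈ orderLT n k) : LeftLinear D := by
  refine orderLT_induction (p := LeftLinear) ?_ ?_ (fun D E => LeftLinear.add) hD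
  · intro j _ F
    refine LeftLinear.mul ?_ (leftLinear_mulBy F)
    clear * -
    induction j with
    | zero => rw [pow_zero, ← mulBy_one]; exact leftLinear_mulBy 1
    | succ j ih => rw [pow_succ]; exact ih.mul leftLinear_del
  · intro L P
    simp [actRight_zero]

/-- A second-order operator `∂² q + ∂ r` with scalar coefficients. -/
def scalarOp (n : Type) [Fintype n] [DecidableEq n] (q r : ℂ[X]) : RightOp n :=
  del n ^ 2 * mulBy (q • 1) + del n * mulBy (r • 1)

lemma actRight_scalarOp (q r : ℂ[X]) (P : MatPoly n) :
    actRight P (scalarOp n q r) = q • matDeriv (matDeriv P) + r • matDeriv P := by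
  rw [scalarOp, actRight_add, actRight_mul, actRight_mul, pow_two, actRight_mul, actRight_del,
    actRight_del, actRight_mulBy, actRight_mulBy, mul_smul_comm, mul_smul_comm, mul_one, mul_one]

lemma matDeriv_smul_one (q : ℂ[X]) :
    matDeriv (q • (1 : MatPoly n)) = derivative q • (1 : MatPoly n) := by
  ext1 i j
  by_cases h : i = j <;> simp [h]

/-- The top terms of a commutator with ∂²q cancel, so moving q past ∂^k must be tracked to second
order. The extra ∂ on the left keeps the second exponent at k, avoiding k - 1. -/
lemma del_mul_mulBy_smul_one_mul_del_pow (q : ℂ[X]) (k : ℕ) :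
    del n * mulBy (q • (1 : MatPoly n)) * del n ^ k - del n ^ (k + 1) * mulBy (q • 1) -
      del n ^ k * mulBy (((k : ℂ[X]) * derivative q) • 1) ∈ orderLT n k := by
  induction k with
  | zero => simp [mulBy_zero]
  | succ k ih =>
    have h1 := mul_del_mem ih
    have h2 := monomial_mem (Nat.lt_succ_self k)
      (matDeriv (((k : ℂ[X]) * derivative q) • (1 : MatPoly n)))
    convert add_mem h1 h2 using 1
    have e : mulBy ((((k + 1 : ℕ) : ℂ[X]) * derivative q) • (1 : MatPoly n)) =
        mulBy (((k : ℂ[X]) * derivative q) • (1 : MatPoly n)) +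
          mulBy (derivative q • (1 : MatPoly n)) := by
      rw [← mulBy_add, ← add_smul]
      congr 2
      push_cast
      ring
    rw [e, sub_mul, sub_mul, mul_assoc (del n ^ (k + 1)) _ (del n), mul_assoc (del n ^ k) _ (del n),
      mulBy_mul_del, mulBy_mul_del, matDeriv_smul_one q, pow_succ _ (k + 1), pow_succ _ k]
    simp only [mul_add, mul_assoc]
    abel

/-- The commutator of `∂ ^ k G` and `∂² q + ∂ r` up to terms of order at most `k`. -/
lemma hasTop_commutator_monomial (q r : ℂ[X]) (k : ℕ) (G : MatPoly n) :
    HasTop (del n ^ k * mulBy G * scalarOp n q r - scalarOp n q r * (del n ^ k * mulBy G))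
      (k + 1) ((2 * q) • matDeriv G - ((k : ℂ[X]) * derivative q) • G) := by
  have h1 := mul_mulBy_mem (del_pow_mul_mem 1 (del_mul_mulBy_smul_one_mul_del_pow (n := n) q k)) G
  have h2 := mul_mulBy_mem
    (del_pow_mul_mem 1 (mulBy_mul_del_pow_sub_mem (r • (1 : MatPoly n)) k)) G
  have h3 := monomial_mem (Nat.lt_succ_self k) (q • matDeriv (matDeriv G))
  have h4 := monomial_mem (Nat.lt_succ_self k) (r • matDeriv G)
  rw [add_comm 1 k] at h1 h2
  rw [HasTop]
  convert sub_mem (sub_mem (add_mem h3 h4) h1) h2 using 1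
  have e1 : mulBy ((2 * q) • matDeriv G - ((k : ℂ[X]) * derivative q) • G) =
      mulBy (matDeriv G) * mulBy (q • 1) + mulBy (matDeriv G) * mulBy (q • 1) -
        mulBy (((k : ℂ[X]) * derivative q) • 1) * mulBy G := by
    rw [mulBy_mul, mulBy_mul, ← mulBy_add, ← mulBy_sub]
    simp [two_mul, add_smul]
  have e2 : ∀ (s : ℂ[X]) (F : MatPoly n), mulBy (s • F) = mulBy F * mulBy (s • 1) := by
    intro s F
    simp [mulBy_mul]
  have e3 : ∀ s : ℂ[X], mulBy (s • 1) * mulBy G = mulBy G * mulBy (s • 1) := by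
    intro s
    simp [mulBy_mul]
  rw [e1, e2 q (matDeriv (matDeriv G)), e2 r (matDeriv G), scalarOp]
  have f1 := mulBy_mul_del G
  have f2 := mulBy_mul_del (matDeriv G)
  have f3 := e3 q
  have f4 := e3 r
  -- From here on only an identity between words in noncommuting letters remains, with `f1`–`f4` as
  -- rewriting rules.
  generalize mulBy (q • (1 : MatPoly n)) = Q at *
  generalize mulBy (r • (1 : MatPoly n)) = R at *
  generalize mulBy (matDeriv (matDeriv G)) = g2 at *
  generalize mulBy (matDeriv G) = g1 at *
  generalize mulBy G = g at *
  generalize mulBy (((k : ℂ[X]) * derivative q) • (1 : MatPoly n)) = K at *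
  have f5 : g * del n ^ 2 = del n ^ 2 * g + del n * g1 + del n * g1 + g2 := by
    rw [pow_two, ← mul_assoc, f1, add_mul, mul_assoc, f1, f2]
    noncomm_ring
  have f6 : del n ^ k * g * (del n ^ 2 * Q + del n * R) =
      del n ^ k * (g * del n ^ 2) * Q + del n ^ k * (g * del n) * R := by noncomm_ring
  have f7 : (del n ^ (k + 1)) = del n * del n ^ k := pow_succ' _ _
  have f9 : del n ^ k * del n = del n * del n ^ k := (pow_succ _ _).symm.trans (pow_succ' _ _)
  have f10 : ∀ x, del n ^ k * (del n * x) = del n * (del n ^ k * x) := fun x => by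
    rw [← mul_assoc, f9, mul_assoc]
  rw [f6, f1, f5, f7, pow_two]
  simp only [add_mul, sub_mul, mul_add, mul_sub, mul_assoc, f3, f4, f10, pow_one]
  abel

/-- If `D` commutes with `∂² q + ∂ r`, its leading coefficient `G` at order `k` satisfies
`2 q G' = k q' G`. -/
lemma HasTop.of_commute {q r : ℂ[X]} {D : RightOp n} {k : ℕ} {G : MatPoly n} (h : HasTop D k G)
    (hD : Commute D (scalarOp n q r)) :
    (2 * q) • matDeriv G = ((k : ℂ[X]) * derivative q) • G := by
  -- Commuting with a second-order scalar operator raises order by at most one, so the lower part of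
  -- D cannot reach order k + 1.
  have key : ∀ E ∈ orderLT n k,
      E * scalarOp n q r - scalarOp n q r * E ∈ orderLT n (k + 1) := by
    intro E hE
    refine orderLT_induction
      (p := fun E => E * scalarOp n q r - scalarOp n q r * E ∈ orderLT n (k + 1))
      ?_ (by simp) ?_ hE
    · intro j hj F
      exact orderLT_mono (by omega) (hasTop_commutator_monomial q r j F).mem
    · intro D E h1 h2
      convert add_mem h1 h2 using 1
      noncomm_ring
  refine sub_eq_zero.1 ((hasTop_commutator_monomial q r k G).eq_zero ?_)
  have := key _ h
  rw [sub_mul, mul_sub, hD.eq] at this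
  convert neg_mem this using 1
  abel

end Operators

/-! ### The operators 𝒱 and 𝒩, their factorization, and the explicit D_i. -/

lemma matPoly_ext_eval {F G : MatPoly (Fin 2)}
    (h : ∀ (x : ℂ) (i j : Fin 2), (F i j).eval x = (G i j).eval x) : F = G := by
  ext1 i j
  exact Polynomial.funext fun x => h x i j

lemma firstOrder_mul (A₁ A₀ B₁ B₀ : MatPoly (Fin 2)) :
    (del (Fin 2) * mulBy A₁ + mulBy A₀) * (del (Fin 2) * mulBy B₁ + mulBy B₀) =
      del (Fin 2) ^ 2 * mulBy (A₁ * B₁) +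
        del (Fin 2) * mulBy (matDeriv A₁ * B₁ + A₁ * B₀ + A₀ * B₁) +
        mulBy (matDeriv A₀ * B₁ + A₀ * B₀) := by
  have h : ∀ F G : MatPoly (Fin 2), mulBy F * (del (Fin 2) * mulBy G) =
      del (Fin 2) * mulBy (F * G) + mulBy (matDeriv F * G) := fun F G => by
    rw [← mul_assoc, mulBy_mul_del, add_mul, mul_assoc, mulBy_mul, mulBy_mul]
  rw [add_mul, mul_add, mul_add, mul_assoc, h, mul_assoc, mulBy_mul, h, mulBy_mul]
  simp only [mulBy_add, mul_add, pow_two, mul_assoc]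
  abel

lemma firstOrder_mul_mulBy (A₁ A₀ F : MatPoly (Fin 2)) :
    (del (Fin 2) * mulBy A₁ + mulBy A₀) * mulBy F =
      del (Fin 2) * mulBy (A₁ * F) + mulBy (A₀ * F) := by
  rw [add_mul, mul_assoc, mulBy_mul, mulBy_mul]

/-- `1 - x²`. -/
def qPoly : ℂ[X] := 1 - X ^ 2

/-- The first-order coefficient of the Jacobi operator with parameters `(α + 1, β + 1)`. -/
def rPoly (α β : ℝ) : ℂ[X] := rc (β - α) - rc (α + β + 4) * X

/-- The Jacobi operator with parameters `(α + 1, β + 1)`, acting entrywise. -/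
def jacobiOp (α β : ℝ) : RightOp (Fin 2) := scalarOp (Fin 2) qPoly (rPoly α β)

/-- The leading coefficient of `𝒱`. -/
def vLead (α β v : ℝ) : MatPoly (Fin 2) :=
  !![X + rc ((β - α) / v), rc (1 + (β - α) / v);
     rc (1 + (α - β) / v), X + rc ((α - β) / v)]

/-- The leading coefficient of `𝒩`. -/
def nLead (α β v : ℝ) : MatPoly (Fin 2) :=
  !![-X + rc ((β - α) / v), rc (1 + (β - α) / v);
     rc (1 + (α - β) / v), -X + rc ((α - β) / v)]

/-- The constant term of `𝒱`. -/
def vConst (α β v : ℝ) : MatPoly (Fin 2) :=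
  !![rc ((v + 2 + α + β) / 2), 0; 0, rc ((-v + 2 + α + β) / 2)]

/-- The constant term of `𝒩`. -/
def nConst (α β v : ℝ) : MatPoly (Fin 2) :=
  !![rc (-(-v + 4 + α + β) / 2), 0; 0, rc (-(α + β + v + 4) / 2)]

lemma jacobiV_eq (α β v : ℝ) :
    jacobiV α β v = del (Fin 2) * mulBy (vLead α β v) + mulBy (vConst α β v) := rfl

lemma jacobiN_eq (α β v : ℝ) :
    jacobiN α β v = del (Fin 2) * mulBy (nLead α β v) + mulBy (nConst α β v) := rfl

/-- The eigenvalue shifts in `𝒱𝒩 = δ - diag(t)`. -/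
def jacobiShift (α β v : ℝ) : Fin 2 → ℝ :=
  ![(v + 2 + α + β) * (-v + 4 + α + β) / 4, (-v + 2 + α + β) * (α + β + v + 4) / 4]

/-- The two factors are S + x and S - x for a constant matrix S with trace 0 and determinant -1, so
S² = 1. -/
lemma vLead_mul_nLead {α β v : ℝ} (hv : v ≠ 0) :
    vLead α β v * nLead α β v = qPoly • (1 : MatPoly (Fin 2)) := by
  have hv' : (v : ℂ) ≠ 0 := by exact_mod_cast hv
  refine matPoly_ext_eval fun x i j => ?_
  fin_cases i <;> fin_cases j <;>
    simp [vLead, nLead, qPoly, rc, Matrix.mul_apply, Fin.sum_univ_two] <;> field_simp <;> ring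

lemma nLead_mul_vLead {α β v : ℝ} (hv : v ≠ 0) :
    nLead α β v * vLead α β v = qPoly • (1 : MatPoly (Fin 2)) := by
  have hv' : (v : ℂ) ≠ 0 := by exact_mod_cast hv
  refine matPoly_ext_eval fun x i j => ?_
  fin_cases i <;> fin_cases j <;>
    simp [vLead, nLead, qPoly, rc, Matrix.mul_apply, Fin.sum_univ_two] <;> field_simp <;> ring

lemma matDeriv_vLead (α β v : ℝ) : matDeriv (vLead α β v) = 1 := by
  ext1 i j
  fin_cases i <;> fin_cases j <;> simp [vLead, rc]

lemma matDeriv_nLead (α β v : ℝ) : matDeriv (nLead α β v) = -1 := by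
  ext1 i j
  fin_cases i <;> fin_cases j <;> simp [nLead, rc]

lemma matDeriv_vConst (α β v : ℝ) : matDeriv (vConst α β v) = 0 := by
  ext1 i j
  fin_cases i <;> fin_cases j <;> simp [vConst, rc]

lemma matDeriv_nConst (α β v : ℝ) : matDeriv (nConst α β v) = 0 := by
  ext1 i j
  fin_cases i <;> fin_cases j <;> simp [nConst, rc]

/-- The Darboux factorization on which everything rests: in this order the product is a scalar
operator up to a constant diagonal matrix. -/
lemma jacobiV_mul_jacobiN {α β v : ℝ} (hv : v ≠ 0) :
    jacobiV α β v * jacobiN α β v =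
      jacobiOp α β - mulBy (Matrix.diagonal fun i => rc (jacobiShift α β v i)) := by
  have hv' : (v : ℂ) ≠ 0 := by exact_mod_cast hv
  rw [jacobiV_eq, jacobiN_eq, firstOrder_mul, vLead_mul_nLead hv, matDeriv_vLead, matDeriv_vConst,
    jacobiOp, scalarOp, zero_mul, zero_add, one_mul]
  have h1 : nLead α β v + vLead α β v * nConst α β v + vConst α β v * nLead α β v =
      rPoly α β • 1 := by
    refine matPoly_ext_eval fun x i j => ?_
    fin_cases i <;> fin_cases j <;>
      simp [vLead, nLead, vConst, nConst, rPoly, rc] <;>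
      field_simp <;> ring
  have h2 : vConst α β v * nConst α β v =
      -Matrix.diagonal fun i => rc (jacobiShift α β v i) := by
    refine matPoly_ext_eval fun x i j => ?_
    fin_cases i <;> fin_cases j <;>
      simp [vConst, nConst, jacobiShift, rc, Matrix.mul_apply, Fin.sum_univ_two]  <;> ring
  rw [h1, h2, ← sub_eq_zero]
  rw [← zero_sub (Matrix.diagonal _), mulBy_sub, mulBy_zero]
  abel

lemma jacobiD_eq (α β v : ℝ) (i j : Fin 2) :
    jacobiD α β v i j =
      del (Fin 2) ^ 2 * mulBy (nLead α β v * Matrix.single i j 1 * vLead α β v) +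
        del (Fin 2) * mulBy (-Matrix.single i j 1 * vLead α β v +
          nLead α β v * Matrix.single i j 1 * vConst α β v +
          nConst α β v * Matrix.single i j 1 * vLead α β v) +
        mulBy (nConst α β v * Matrix.single i j 1 * vConst α β v) := by
  have hE : matDeriv (Matrix.single i j 1 : MatPoly (Fin 2)) = 0 := by
    ext1 a b
    simp only [Matrix.map_apply, Matrix.single_apply, Matrix.zero_apply]
    split_ifs <;> simp
  rw [jacobiD, jacobiV_eq, jacobiN_eq, firstOrder_mul_mulBy, firstOrder_mul, matDeriv_mul,
    matDeriv_mul, hE, matDeriv_nLead, matDeriv_nConst]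
  simp

lemma jacobiD_eq_of {α β v : ℝ} {i j : Fin 2} {A B F : MatPoly (Fin 2)}
    (hA : nLead α β v * Matrix.single i j 1 * vLead α β v = A)
    (hB : -Matrix.single i j 1 * vLead α β v +
          nLead α β v * Matrix.single i j 1 * vConst α β v +
          nConst α β v * Matrix.single i j 1 * vLead α β v = B)
    (hF : nConst α β v * Matrix.single i j 1 * vConst α β v = F) :
    jacobiD α β v i j = del (Fin 2) ^ 2 * mulBy A + del (Fin 2) * mulBy B + mulBy F := by
  rw [jacobiD_eq, hA, hB, hF]

theorem jacobiD_zero_zero {α β v : ℝ} (hv : v ≠ 0) :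
    jacobiD α β v 0 0 =
      del (Fin 2) ^ 2 * mulBy
        !![-X ^ 2 + rc ((α - β) ^ 2 / v ^ 2),
           (rc v * X + rc (α - β)) * rc ((-v + α - β) / v ^ 2);
           (rc v * X - rc (α - β)) * rc ((v - β + α) / v ^ 2),
           rc (1 - (α - β) ^ 2 / v ^ 2)]
      + del (Fin 2) * mulBy
        !![-X * rc (α + β + 4) - rc ((v - 2) * (α - β) / v),
           rc ((-v + α - β) * (α + β - v + 6) / (2 * v));
           rc ((v - β + α) * (v + 2 + α + β) / (2 * v)),
           0]
      + mulBy
        !![rc (-((-v + 4 + α + β) * (v + 2 + α + β) / 4)), 0;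
           0, 0] := by
  have hv' : (v : ℂ) ≠ 0 := by exact_mod_cast hv
  have hE : (Matrix.single 0 0 1 : MatPoly (Fin 2)) = !![1, 0; 0, 0] := by
    ext1 i j
    fin_cases i <;> fin_cases j <;> simp
  apply jacobiD_eq_of <;> rw [hE] <;> refine matPoly_ext_eval fun x i j => ?_ <;>
    fin_cases i <;> fin_cases j <;>
      simp [vLead, nLead, vConst, nConst, rc] <;> field_simp <;> ring

theorem jacobiD_zero_one {α β v : ℝ} (hv : v ≠ 0) :
    jacobiD α β v 0 1 =
      del (Fin 2) ^ 2 * mulBy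
        !![(rc v * X + rc (α - β)) * rc ((-v + β - α) / v ^ 2),
           -((rc v * X + rc (α - β)) ^ 2 * rc (1 / v ^ 2));
           rc ((v - β + α) ^ 2 / v ^ 2),
           (rc v * X + rc (α - β)) * rc ((v - β + α) / v ^ 2)]
      + del (Fin 2) * mulBy
        !![rc ((-v + β - α) * (α + β - v + 6) / (2 * v)),
           -(rc ((-v + 4 + α + β) / v) * (rc v * X + rc (α - β)));
           0,
           rc ((v - β + α) * (-v + 2 + α + β) / (2 * v))]
      + mulBy
        !![0, rc (-((-v + 4 + α + β) * (-v + 2 + α + β) / 4));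
           0, 0] := by
  have hv' : (v : ℂ) ≠ 0 := by exact_mod_cast hv
  have hE : (Matrix.single 0 1 1 : MatPoly (Fin 2)) = !![0, 1; 0, 0] := by
    ext1 i j
    fin_cases i <;> fin_cases j <;> simp
  apply jacobiD_eq_of <;> rw [hE] <;> refine matPoly_ext_eval fun x i j => ?_ <;>
    fin_cases i <;> fin_cases j <;>
      simp [vLead, nLead, vConst, nConst, rc] <;> field_simp <;> ring

theorem jacobiD_one_zero {α β v : ℝ} (hv : v ≠ 0) :
    jacobiD α β v 1 0 =
      del (Fin 2) ^ 2 * mulBy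
        !![(-(rc v * X) + rc (α - β)) * rc ((-v + α - β) / v ^ 2),
           rc ((-v + α - β) ^ 2 / v ^ 2);
           -((-(rc v * X) + rc (α - β)) ^ 2 * rc (1 / v ^ 2)),
           (-(rc v * X) + rc (α - β)) * rc ((v - α + β) / v ^ 2)]
      + del (Fin 2) * mulBy
        !![rc (-((v + 2 + α + β) * (-v + α - β) / (2 * v))),
           0;
           rc ((α + β + v + 4) / v) * (-(rc v * X) + rc (α - β)),
           rc ((α + β + v + 6) * (-v + α - β) / (2 * v))]
      + mulBy
        !![0, 0;
           rc (-((α + β + v + 4) * (v + 2 + α + β) / 4)), 0] := by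
  have hv' : (v : ℂ) ≠ 0 := by exact_mod_cast hv
  have hE : (Matrix.single 1 0 1 : MatPoly (Fin 2)) = !![0, 0; 1, 0] := by
    ext1 i j
    fin_cases i <;> fin_cases j <;> simp
  apply jacobiD_eq_of <;> rw [hE] <;> refine matPoly_ext_eval fun x i j => ?_ <;>
    fin_cases i <;> fin_cases j <;>
      simp [vLead, nLead, vConst, nConst, rc] <;> field_simp <;> ring

theorem jacobiD_one_one {α β v : ℝ} (hv : v ≠ 0) :
    jacobiD α β v 1 1 =
      del (Fin 2) ^ 2 * mulBy
        !![rc (1 - (α - β) ^ 2 / v ^ 2),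
           (rc v * X + rc (α - β)) * rc ((v + β - α) / v ^ 2);
           (-(rc v * X) + rc (α - β)) * rc ((v - β + α) / v ^ 2),
           -X ^ 2 + rc ((α - β) ^ 2 / v ^ 2)]
      + del (Fin 2) * mulBy
        !![0,
           rc ((v - α + β) * (-v + 2 + α + β) / (2 * v));
           rc (-((v - β + α) * (α + β + v + 6) / (2 * v))),
           -X * rc (α + β + 4) - rc ((v + 2) * (α - β) / v)]
      + mulBy
        !![0, 0;
           0, rc (-((α + β + v + 4) * (-v + 2 + α + β) / 4))] := by
  have hv' : (v : ℂ) ≠ 0 := by exact_mod_cast hv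
  have hE : (Matrix.single 1 1 1 : MatPoly (Fin 2)) = !![0, 0; 0, 1] := by
    ext1 i j
    fin_cases i <;> fin_cases j <;> simp
  apply jacobiD_eq_of <;> rw [hE] <;> refine matPoly_ext_eval fun x i j => ?_ <;>
    fin_cases i <;> fin_cases j <;>
      simp [vLead, nLead, vConst, nConst, rc] <;> field_simp <;> ring

/-! ### Scalar Jacobi polynomials as eigenfunctions. -/

/-- The eigenvalue of the Jacobi operator with parameters `(α + 1, β + 1)` in degree `k`. -/
def jacobiEig (α β : ℝ) (k : ℕ) : ℝ := -(k * (k + α + β + 3))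

/-- Coefficients of the Jacobi polynomial of degree `m` in powers of `x - 1`. -/
def jacobiCoeff (α β : ℝ) (m k : ℕ) : ℝ :=
  ∏ i ∈ Finset.range k,
    (jacobiEig α β i - jacobiEig α β m) / (2 * (i + 1) * (i + α + 2))

/-- The Jacobi polynomial of degree `m` with parameters `(α + 1, β + 1)`, up to normalisation. -/
def jacobiPoly (α β : ℝ) (m : ℕ) : ℂ[X] :=
  ∑ k ∈ Finset.range (m + 1), rc (jacobiCoeff α β m k) * (X - 1) ^ k

lemma jacobiEig_lt {α β : ℝ} (hα : -1 < α) (hβ : -1 < β) {k m : ℕ} (h : k < m) :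
    jacobiEig α β m < jacobiEig α β k := by
  have h1 : (k : ℝ) < m := by exact_mod_cast h
  have h2 : (0 : ℝ) ≤ k := by positivity
  unfold jacobiEig
  nlinarith

lemma jacobiEig_injective {α β : ℝ} (hα : -1 < α) (hβ : -1 < β) {k m : ℕ} (h : k ≠ m) :
    jacobiEig α β k ≠ jacobiEig α β m := by
  rcases lt_or_gt_of_ne h with h | h
  · exact (jacobiEig_lt hα hβ h).ne'
  · exact (jacobiEig_lt hα hβ h).ne

lemma rc_sub (a b : ℝ) : rc (a - b) = rc a - rc b := by simp [rc]
lemma rc_mul (a b : ℝ) : rc (a * b) = rc a * rc b := by simp [rc]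

lemma jacobiCoeff_succ {α : ℝ} (hα : -1 < α) (β : ℝ) (m k : ℕ) :
    jacobiCoeff α β m (k + 1) * (2 * (k + 1) * (k + α + 2)) =
      (jacobiEig α β k - jacobiEig α β m) * jacobiCoeff α β m k := by
  have h1 : (k : ℝ) + α + 2 ≠ 0 := by
    have : (0 : ℝ) ≤ k := by positivity
    linarith
  have h2 : (k : ℝ) + 1 ≠ 0 := by positivity
  rw [jacobiCoeff, Finset.prod_range_succ, ← jacobiCoeff]
  field_simp

lemma jacobiCoeff_ne_zero {α β : ℝ} (hα : -1 < α) (hβ : -1 < β) {m k : ℕ} (h : k ≤ m) :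
    jacobiCoeff α β m k ≠ 0 := by
  refine Finset.prod_ne_zero_iff.2 fun i hi => div_ne_zero ?_ ?_
  · exact sub_ne_zero.2 (jacobiEig_lt hα hβ ((Finset.mem_range.1 hi).trans_le h)).ne'
  · have h1 : (0 : ℝ) ≤ i := by positivity
    have h2 : (0 : ℝ) < i + α + 2 := by linarith
    positivity

/-- The Jacobi operator on scalar polynomials. -/
def jacobiScalarOp (α β : ℝ) (p : ℂ[X]) : ℂ[X] :=
  qPoly * derivative (derivative p) + rPoly α β * derivative p

lemma jacobiScalarOp_add (α β : ℝ) (p s : ℂ[X]) :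
    jacobiScalarOp α β (p + s) = jacobiScalarOp α β p + jacobiScalarOp α β s := by
  simp only [jacobiScalarOp, derivative_add]
  ring

/-- With t = x - 1 one has 1 - x² = -t² - 2t, so the operator is bidiagonal in powers of t. At k = 0
the truncated exponent is harmless because its coefficient vanishes. -/
lemma jacobiScalarOp_pow (α β a : ℝ) (k : ℕ) :
    jacobiScalarOp α β (rc a * (X - 1) ^ k) =
      rc (jacobiEig α β k) * (rc a * (X - 1) ^ k) -
        rc (a * (2 * k * (k + α + 1))) * (X - 1) ^ (k - 1) := by
  have h : jacobiScalarOp α β (rc a * (X - 1) ^ k) =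
      rc a * (qPoly * ((k : ℂ[X]) * (((k - 1 : ℕ) : ℂ[X]) * (X - 1) ^ (k - 1 - 1))) +
        rPoly α β * ((k : ℂ[X]) * (X - 1) ^ (k - 1))) := by
    have d : ∀ j : ℕ, derivative ((X - 1 : ℂ[X]) ^ j) = (j : ℂ[X]) * (X - 1) ^ (j - 1) :=
      fun j => by simpa using derivative_X_sub_C_pow (1 : ℂ) j
    simp only [jacobiScalarOp, rc, derivative_C_mul, d, derivative_natCast_mul]
    ring
  rw [h]
  refine Polynomial.funext fun x => ?_
  rcases k with _ | _ | k
  · simp [jacobiEig, rc]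
  · simp [jacobiEig, rc, rPoly, qPoly]
    ring
  · simp [jacobiEig, rc, rPoly, qPoly, pow_succ]
    ring

lemma jacobiScalarOp_jacobiPoly {α : ℝ} (hα : -1 < α) (β : ℝ) (m : ℕ) :
    jacobiScalarOp α β (jacobiPoly α β m) = rc (jacobiEig α β m) * jacobiPoly α β m := by
  -- The coefficient recursion telescopes: a partial sum misses the eigenvalue equation by a single
  -- top term, which vanishes at l = m.
  have key : ∀ l : ℕ, jacobiScalarOp α β
        (∑ k ∈ Finset.range (l + 1), rc (jacobiCoeff α β m k) * (X - 1) ^ k) =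
      rc (jacobiEig α β m) *
          ∑ k ∈ Finset.range (l + 1), rc (jacobiCoeff α β m k) * (X - 1) ^ k +
        rc ((jacobiEig α β l - jacobiEig α β m) * jacobiCoeff α β m l) * (X - 1) ^ l := by
    intro l
    induction l with
    | zero =>
      have := jacobiScalarOp_pow α β (jacobiCoeff α β m 0) 0
      simp only [zero_add, Finset.sum_range_one, this]
      simp only [rc_sub, rc_mul, Nat.cast_zero]
      simp [rc]
      ring
    | succ l ih =>
      have h1 := jacobiCoeff_succ hα β m l
      have h2 := jacobiScalarOp_pow α β (jacobiCoeff α β m (l + 1)) (l + 1)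
      rw [Finset.sum_range_succ, jacobiScalarOp_add, ih, h2, ← h1]
      have h3 : jacobiCoeff α β m (l + 1) * (2 * ((l + 1 : ℕ) : ℝ) * (((l + 1 : ℕ) : ℝ) + α + 1)) =
          jacobiCoeff α β m (l + 1) * (2 * (l + 1) * (l + α + 2)) := by
        push_cast
        ring
      rw [h3, Nat.add_sub_cancel, rc_mul (_ - _), rc_sub]
      ring
  rw [jacobiPoly, key]
  simp [rc]

lemma jacobiPoly_natDegree_le (α β : ℝ) (m : ℕ) : (jacobiPoly α β m).degree ≤ m := by
  refine (degree_sum_le _ _).trans (Finset.sup_le fun k hk => ?_)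
  have hk' : k ≤ m := Nat.lt_succ_iff.1 (Finset.mem_range.1 hk)
  rw [rc, degree_mul, degree_pow, ← C_1, degree_X_sub_C, nsmul_one]
  calc _ ≤ (0 : WithBot ℕ) + k := add_le_add_left degree_C_le _
    _ ≤ m := by rw [zero_add]; exact_mod_cast hk'

lemma jacobiPoly_coeff {α β : ℝ} (hα : -1 < α) (hβ : -1 < β) (m : ℕ) :
    (jacobiPoly α β m).coeff m ≠ 0 := by
  have h : (jacobiPoly α β m).coeff m = (jacobiCoeff α β m m : ℂ) := by
    rw [jacobiPoly, finsetSum_coeff, Finset.sum_range_succ, Finset.sum_eq_zero, zero_add, rc,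
      coeff_C_mul]
    · have := ((monic_X_sub_C (1 : ℂ)).pow m).coeff_natDegree
      rw [natDegree_pow, natDegree_X_sub_C, mul_one, C_1] at this
      rw [this, mul_one]
    · intro k hk
      rw [rc, coeff_C_mul, coeff_eq_zero_of_natDegree_lt, mul_zero]
      rw [natDegree_pow, ← C_1, natDegree_X_sub_C, mul_one]
      exact Finset.mem_range.1 hk
  rw [h]
  exact_mod_cast jacobiCoeff_ne_zero hα hβ le_rfl

lemma map_conj_rc (a : ℝ) : (rc a).map (starRingEnd ℂ) = rc a := by
  simp [rc]

lemma map_conj_jacobiPoly (α β : ℝ) (m : ℕ) :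
    (jacobiPoly α β m).map (starRingEnd ℂ) = jacobiPoly α β m := by
  simp [jacobiPoly, Polynomial.map_sum, map_conj_rc]

lemma actRight_jacobiOp (α β : ℝ) (p : ℂ[X]) :
    actRight (p • (1 : MatPoly (Fin 2))) (jacobiOp α β) =
      jacobiScalarOp α β p • (1 : MatPoly (Fin 2)) := by
  rw [jacobiOp, actRight_scalarOp, matDeriv_smul_one, matDeriv_smul_one, smul_smul, smul_smul,
    ← add_smul, jacobiScalarOp]

/-! ### Integration against the Jacobi density. -/

/-- The scalar Jacobi density `(1 - x)^α (1 + x)^β`. -/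
def jacobiDensity (α β x : ℝ) : ℝ := (1 - x) ^ α * (1 + x) ^ β

lemma intervalIntegrable_jacobiDensity {α β : ℝ} (hα : -1 < α) (hβ : -1 < β) :
    IntervalIntegrable (jacobiDensity α β) volume (-1) 1 := by
  have hl : IntervalIntegrable (fun x : ℝ => (1 + x) ^ β) volume (-1) 0 := by
    have := (intervalIntegral.intervalIntegrable_rpow' (a := 0) (b := 1) hβ).comp_add_left 1
    simpa using this
  have hr : IntervalIntegrable (fun x : ℝ => (1 - x) ^ α) volume 0 1 := by
    have := (intervalIntegral.intervalIntegrable_rpow' (a := 1) (b := 0) hα).comp_sub_left 1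
    simpa using this
  refine (hl.continuousOn_mul ?_).trans (hr.mul_continuousOn ?_)
  · refine ContinuousOn.rpow_const (by fun_prop) fun x hx => Or.inl ?_
    rw [Set.uIcc_of_le (by norm_num)] at hx
    linarith [hx.2]
  · refine ContinuousOn.rpow_const (by fun_prop) fun x hx => Or.inl ?_
    rw [Set.uIcc_of_le (by norm_num)] at hx
    linarith [hx.1]

lemma integrableOn_jacobiDensity_mul {α β : ℝ} (hα : -1 < α) (hβ : -1 < β) (h : ℂ[X]) :
    IntegrableOn (fun x : ℝ => (jacobiDensity α β x : ℂ) * h.eval (x : ℂ)) (Set.Ioo (-1) 1) := by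
  have h1 : IntegrableOn (jacobiDensity α β) (Set.Ioo (-1) 1) :=
    ((intervalIntegrable_iff_integrableOn_Ioo_of_le (by norm_num)).1
      (intervalIntegrable_jacobiDensity hα hβ))
  refine IntegrableOn.mul_continuousOn_of_subset (K := Set.Icc (-1) 1) h1.ofReal ?_
    measurableSet_Ioo isCompact_Icc Set.Ioo_subset_Icc_self
  exact (h.continuous.comp Complex.continuous_ofReal).continuousOn

/-- The moment functional of the scalar Jacobi density. -/
def jacobiFunctional (α β : ℝ) (h : ℂ[X]) : ℂ :=
  ∫ x in Set.Ioo (-1 : ℝ) 1, (jacobiDensity α β x : ℂ) * h.eval (x : ℂ)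

lemma jacobiFunctional_add {α β : ℝ} (hα : -1 < α) (hβ : -1 < β) (f g : ℂ[X]) :
    jacobiFunctional α β (f + g) = jacobiFunctional α β f + jacobiFunctional α β g := by
  rw [jacobiFunctional, jacobiFunctional, jacobiFunctional, ← integral_add
    (integrableOn_jacobiDensity_mul hα hβ f) (integrableOn_jacobiDensity_mul hα hβ g)]
  simp [mul_add]

lemma jacobiFunctional_C_mul (α β : ℝ) (a : ℂ) (f : ℂ[X]) :
    jacobiFunctional α β (C a * f) = a * jacobiFunctional α β f := by
  rw [jacobiFunctional, jacobiFunctional, ← integral_const_mul]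
  simp [mul_left_comm]

lemma jacobiFunctional_zero (α β : ℝ) : jacobiFunctional α β 0 = 0 := by
  simp [jacobiFunctional]

lemma jacobiFunctional_neg (α β : ℝ) (f : ℂ[X]) :
    jacobiFunctional α β (-f) = -jacobiFunctional α β f := by
  simpa using jacobiFunctional_C_mul α β (-1) f

/-- The logarithmic derivative of `(1 - x)^(α + 1) (1 + x)^(β + 1)` times `1 - x²`. -/
def pearsonPoly (α β : ℝ) : ℂ[X] := rc (β + 1) * (1 - X) - rc (α + 1) * (1 + X)

/-- The integrand is the derivative of (1 - x)^(α+1) (1 + x)^(β+1) h, which vanishes at both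
endpoints because the exponents are positive. -/
lemma jacobiFunctional_derivative {α β : ℝ} (hα : -1 < α) (hβ : -1 < β) (h : ℂ[X]) :
    jacobiFunctional α β (qPoly * derivative h + pearsonPoly α β * h) = 0 := by
  have hc : ContinuousOn (fun x : ℝ => (jacobiDensity (α + 1) (β + 1) x : ℂ) * h.eval (x : ℂ))
      (Set.Icc (-1) 1) := by
    refine Continuous.continuousOn (Continuous.mul (Complex.continuous_ofReal.comp ?_)
      (h.continuous.comp Complex.continuous_ofReal))
    refine Continuous.mul (Continuous.rpow_const (by fun_prop) fun x => Or.inr (by linarith))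
      (Continuous.rpow_const (by fun_prop) fun x => Or.inr (by linarith))
  have hd : ∀ x ∈ Set.Ioo (-1 : ℝ) 1,
      HasDerivAt (fun x : ℝ => (jacobiDensity (α + 1) (β + 1) x : ℂ) * h.eval (x : ℂ))
        ((jacobiDensity α β x : ℂ) *
          (qPoly * derivative h + pearsonPoly α β * h).eval (x : ℂ)) x := by
    intro x hx
    have hx1 : 0 < 1 - x := by linarith [hx.2]
    have hx2 : 0 < 1 + x := by linarith [hx.1]
    have d1 : HasDerivAt (fun x : ℝ => (1 - x) ^ (α + 1)) (-1 * (α + 1) * (1 - x) ^ (α + 1 - 1)) x :=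
      ((hasDerivAt_id x).const_sub 1).rpow_const (Or.inl hx1.ne')
    have d2 : HasDerivAt (fun x : ℝ => (1 + x) ^ (β + 1)) (1 * (β + 1) * (1 + x) ^ (β + 1 - 1)) x :=
      ((hasDerivAt_id x).const_add 1).rpow_const (Or.inl hx2.ne')
    have d3 : HasDerivAt (fun x : ℝ => h.eval (x : ℂ)) ((derivative h).eval (x : ℂ)) x :=
      (h.hasDerivAt (x : ℂ)).comp_ofReal
    refine (((d1.mul d2).ofReal_comp).mul d3).congr_deriv ?_
    rw [add_sub_cancel_right, add_sub_cancel_right, Pi.mul_apply, Real.rpow_add_one hx1.ne',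
      Real.rpow_add_one hx2.ne', jacobiDensity]
    simp [qPoly, pearsonPoly, rc]
    ring
  have hi := (intervalIntegrable_iff_integrableOn_Ioo_of_le (by norm_num)).2
    (integrableOn_jacobiDensity_mul hα hβ (qPoly * derivative h + pearsonPoly α β * h))
  have := intervalIntegral.integral_eq_sub_of_hasDerivAt_of_le (by norm_num) hc hd hi
  rw [intervalIntegral.integral_of_le (by norm_num), integral_Ioc_eq_integral_Ioo] at this
  rw [jacobiFunctional, this]
  simp [jacobiDensity, Real.zero_rpow (by linarith : α + 1 ≠ 0),
    Real.zero_rpow (by linarith : β + 1 ≠ 0)]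

lemma eval_map_conj (p : ℂ[X]) (x : ℝ) :
    (p.map (starRingEnd ℂ)).eval (x : ℂ) = starRingEnd ℂ (p.eval (x : ℂ)) := by
  have := eval₂_at_apply (p := p) (starRingEnd ℂ) (x : ℂ)
  rwa [Complex.conj_ofReal, ← eval_map] at this

/-- The integrand is nonnegative, and positive off the finitely many zeros of a nonzero p. -/
lemma eq_zero_of_jacobiFunctional {α β : ℝ} (hα : -1 < α) (hβ : -1 < β) {p : ℂ[X]}
    (hp : jacobiFunctional α β (qPoly * (p * p.map (starRingEnd ℂ))) = 0) : p = 0 := by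
  by_contra hne
  set g : ℝ → ℝ := fun x =>
    jacobiDensity α β x * ((1 - x ^ 2) * Complex.normSq (p.eval (x : ℂ))) with hg
  have e : (fun x : ℝ => (jacobiDensity α β x : ℂ) *
      (qPoly * (p * p.map (starRingEnd ℂ))).eval (x : ℂ)) = fun x => (g x : ℂ) := by
    funext x
    simp only [eval_mul, eval_map_conj, Complex.mul_conj, hg, qPoly]
    simp
  have hi : IntegrableOn g (Set.Ioo (-1) 1) := by
    have := integrableOn_jacobiDensity_mul hα hβ (qPoly * (p * p.map (starRingEnd ℂ)))
    rw [e] at this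
    simpa [IntegrableOn] using this.re
  rw [jacobiFunctional, e, integral_complex_ofReal, Complex.ofReal_eq_zero,
    setIntegral_eq_zero_iff_of_nonneg_ae ?_ hi] at hp
  · rw [Filter.EventuallyEq, ae_restrict_iff' measurableSet_Ioo] at hp
    have hfin : {x : ℝ | p.eval (x : ℂ) = 0}.Finite :=
      (p.finite_setOfPred_isRoot hne).preimage Complex.ofReal_injective.injOn
    have hae : ∀ᵐ x : ℝ, x ∉ {x : ℝ | p.eval (x : ℂ) = 0} :=
      hfin.countable.ae_notMem volume
    have hbad : ∀ᵐ x : ℝ, x ∉ Set.Ioo (-1 : ℝ) 1 := by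
      filter_upwards [hp, hae] with x h1 h2 hx
      have h3 := h1 hx
      have hx1 : 0 < 1 - x := by linarith [hx.2]
      have hx2 : 0 < 1 + x := by linarith [hx.1]
      have h4 : 0 < jacobiDensity α β x := mul_pos (Real.rpow_pos_of_pos hx1 _)
        (Real.rpow_pos_of_pos hx2 _)
      have h5 : 0 < 1 - x ^ 2 := by nlinarith
      have h6 : 0 < Complex.normSq (p.eval (x : ℂ)) := Complex.normSq_pos.2 h2
      exact (mul_pos h4 (mul_pos h5 h6)).ne' h3
    have : volume (Set.Ioo (-1 : ℝ) 1) = 0 := by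
      simpa only [not_not, Set.ofPred_mem_eq] using ae_iff.1 hbad
    rw [Real.volume_Ioo] at this
    norm_num at this
  · rw [Filter.EventuallyLE, ae_restrict_iff' measurableSet_Ioo]
    refine Filter.Eventually.of_forall fun x hx => ?_
    have hx1 : 0 < 1 - x := by linarith [hx.2]
    have hx2 : 0 < 1 + x := by linarith [hx.1]
    have h4 : 0 < jacobiDensity α β x := mul_pos (Real.rpow_pos_of_pos hx1 _)
      (Real.rpow_pos_of_pos hx2 _)
    have h5 : 0 < 1 - x ^ 2 := by nlinarith
    exact mul_nonneg h4.le (mul_nonneg h5.le (Complex.normSq_nonneg _))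

/-! ### Factorization of the weight and the adjoint relation. -/

/-- The adjoint of a matrix polynomial for a real variable. -/
def matStar (P : MatPoly (Fin 2)) : MatPoly (Fin 2) :=
  (P.map (Polynomial.map (starRingEnd ℂ))).transpose

lemma matStar_mul (P Q : MatPoly (Fin 2)) : matStar (P * Q) = matStar Q * matStar P := by
  ext1 i j
  simp [matStar, Matrix.mul_apply, mul_comm]

lemma matStar_add (P Q : MatPoly (Fin 2)) : matStar (P + Q) = matStar P + matStar Q := by
  ext1 i j
  simp [matStar]

lemma matStar_matDeriv (P : MatPoly (Fin 2)) : matStar (matDeriv P) = matDeriv (matStar P) := by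
  ext1 i j
  simp [matStar, derivative_map]

lemma conjTranspose_evalAt (P : MatPoly (Fin 2)) (x : ℝ) :
    (evalAt P x).conjTranspose = evalAt (matStar P) x := by
  ext1 i j
  simp [evalAt, matStar, eval_map_conj]

lemma evalAt_mul (P Q : MatPoly (Fin 2)) (x : ℝ) :
    evalAt (P * Q) x = evalAt P x * evalAt Q x := by
  ext1 i j
  simp [evalAt, Matrix.mul_apply]

/-- The diagonal entries of the weight that `𝒩` intertwines with `W`. -/
def diagWeight (α β v : ℝ) : Fin 2 → ℝ :=
  ![v * (v + 2 + α + β) / (v + α - β) / 4, v * (-v + 2 + α + β) / (v - α + β) / 4]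

/-- The polynomial factor of the weight `W`. -/
def weightPoly (α β v : ℝ) : MatPoly (Fin 2) :=
  nLead α β v * Matrix.diagonal (fun i => rc (diagWeight α β v i)) * (nLead α β v).transpose

lemma nLead_transpose (α β v : ℝ) :
    (nLead α β v).transpose =
      !![-X + rc ((β - α) / v), rc (1 + (α - β) / v);
         rc (1 + (β - α) / v), -X + rc ((α - β) / v)] := by
  ext1 i j
  fin_cases i <;> fin_cases j <;> rfl

lemma jacobiWeight_eq {α β v : ℝ} (hv : v ≠ 0) (h1 : v + α - β ≠ 0) (h2 : v - α + β ≠ 0) (x : ℝ) :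
    jacobiWeight α β v x = (jacobiDensity α β x : ℂ) • evalAt (weightPoly α β v) x := by
  have hv' : (v : ℂ) ≠ 0 := by exact_mod_cast hv
  have h1' : (v : ℂ) + α - β ≠ 0 := by exact_mod_cast h1
  have h2' : (v : ℂ) - α + β ≠ 0 := by exact_mod_cast h2
  have : (Matrix.diagonal fun i => rc (diagWeight α β v i)) =
      !![rc (diagWeight α β v 0), 0; 0, rc (diagWeight α β v 1)] := by
    ext1 i j
    fin_cases i <;> fin_cases j <;> rfl
  rw [weightPoly, this, nLead_transpose]
  ext1 i j
  fin_cases i <;> fin_cases j <;>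
    simp [jacobiWeight, evalAt, diagWeight, jacobiDensity, nLead, rc,
      -mul_eq_mul_left_iff] <;>
    congr 1 <;> field_simp <;> ring

lemma matInner_jacobiWeight {α β v : ℝ} (hv : v ≠ 0) (h1 : v + α - β ≠ 0) (h2 : v - α + β ≠ 0)
    (P Q : MatPoly (Fin 2)) (i j : Fin 2) :
    matInner (Set.Ioo (-1 : ℝ) 1) (jacobiWeight α β v) P Q i j =
      jacobiFunctional α β ((P * weightPoly α β v * matStar Q) i j) := by
  rw [matInner, jacobiFunctional, Matrix.of_apply]
  congr 1
  funext x
  rw [jacobiWeight_eq hv h1 h2, conjTranspose_evalAt, Matrix.mul_smul, Matrix.smul_mul,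
    ← evalAt_mul, ← evalAt_mul]
  rfl

lemma weightPoly_mul_vLead {α β v : ℝ} (hv : v ≠ 0) :
    weightPoly α β v * (vLead α β v).transpose =
      qPoly • (nLead α β v * Matrix.diagonal (fun i => rc (diagWeight α β v i))) := by
  rw [weightPoly, mul_assoc, ← Matrix.transpose_mul, vLead_mul_nLead hv]
  simp

/-- A Pearson-type equation for W: it matches the zero-order terms in the adjoint relation, as
`weightPoly_mul_vLead` matches the first-order ones. The summand -qK comes from differentiating the
leading coefficient of 𝒩. -/
lemma weightPoly_mul_vConst {α β v : ℝ} (hv : v ≠ 0) (h1 : v + α - β ≠ 0)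
    (h2 : v - α + β ≠ 0) :
    weightPoly α β v * vConst α β v =
      pearsonPoly α β • (nLead α β v * Matrix.diagonal (fun i => rc (diagWeight α β v i))) -
      qPoly • Matrix.diagonal (fun i => rc (diagWeight α β v i)) -
      qPoly • (nConst α β v * Matrix.diagonal (fun i => rc (diagWeight α β v i))) := by
  have hv' : (v : ℂ) ≠ 0 := by exact_mod_cast hv
  have h1' : (v : ℂ) + α - β ≠ 0 := by exact_mod_cast h1
  have h2' : (v : ℂ) - α + β ≠ 0 := by exact_mod_cast h2
  have : (Matrix.diagonal fun i => rc (diagWeight α β v i)) =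
      !![rc (diagWeight α β v 0), 0; 0, rc (diagWeight α β v 1)] := by
    ext1 i j
    fin_cases i <;> fin_cases j <;> rfl
  rw [weightPoly, this, nLead_transpose]
  refine matPoly_ext_eval fun x i j => ?_
  fin_cases i <;> fin_cases j <;>
    simp [diagWeight, nLead, vConst, nConst, qPoly, pearsonPoly, rc] <;>
    field_simp <;> ring

lemma matStar_vLead (α β v : ℝ) : matStar (vLead α β v) = (vLead α β v).transpose := by
  ext1 i j
  fin_cases i <;> fin_cases j <;> simp [matStar, vLead, map_conj_rc]

lemma matStar_vConst (α β v : ℝ) : matStar (vConst α β v) = vConst α β v := by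
  ext1 i j
  fin_cases i <;> fin_cases j <;> simp [matStar, vConst, map_conj_rc]

/-- `𝒱` and `-𝒩` are adjoint to each other. -/
lemma jacobiFunctional_adjoint {α β v : ℝ} (hα : -1 < α) (hβ : -1 < β) (hv : v ≠ 0)
    (h1 : v + α - β ≠ 0) (h2 : v - α + β ≠ 0) (P R : MatPoly (Fin 2)) (i j : Fin 2) :
    jacobiFunctional α β ((P * weightPoly α β v * matStar (actRight R (jacobiV α β v))) i j) =
      -jacobiFunctional α β ((qPoly • (actRight P (jacobiN α β v) *
        Matrix.diagonal (fun i => rc (diagWeight α β v i)) * matStar R)) i j) := by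
  set K : MatPoly (Fin 2) := Matrix.diagonal (fun i => rc (diagWeight α β v i)) with hK
  have hKd : matDeriv K = 0 := by
    ext1 a b
    by_cases h : a = b <;> simp [hK, h, rc]
  rw [eq_neg_iff_add_eq_zero, ← jacobiFunctional_add hα hβ]
  -- The two sides add up to an exact derivative, with this product as the boundary term.
  convert jacobiFunctional_derivative hα hβ ((P * nLead α β v * K * matStar R) i j) using 2
  have hR : matStar (actRight R (jacobiV α β v)) =
      (vLead α β v).transpose * matDeriv (matStar R) + vConst α β v * matStar R := by
    rw [jacobiV_eq, actRight_add, actRight_mul, actRight_del, actRight_mulBy, actRight_mulBy,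
      matStar_add, matStar_mul, matStar_mul, matStar_vLead, matStar_vConst, matStar_matDeriv]
  have hP : actRight P (jacobiN α β v) = matDeriv P * nLead α β v + P * nConst α β v := by
    rw [jacobiN_eq, actRight_add, actRight_mul, actRight_del, actRight_mulBy, actRight_mulBy]
  have hd : matDeriv (P * nLead α β v * K * matStar R) =
      matDeriv P * nLead α β v * K * matStar R - P * K * matStar R +
        P * nLead α β v * K * matDeriv (matStar R) := by
    rw [matDeriv_mul, matDeriv_mul, matDeriv_mul, hKd, matDeriv_nLead]
    noncomm_ring
  have key : P * weightPoly α β v * matStar (actRight R (jacobiV α β v)) +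
      qPoly • (actRight P (jacobiN α β v) * K * matStar R) =
      qPoly • matDeriv (P * nLead α β v * K * matStar R) +
        pearsonPoly α β • (P * nLead α β v * K * matStar R) := by
    rw [hR, hP, hd, mul_add, mul_assoc P, ← mul_assoc (weightPoly α β v),
      weightPoly_mul_vLead hv, mul_assoc P, ← mul_assoc (weightPoly α β v),
      weightPoly_mul_vConst hv h1 h2, ← hK]
    simp only [add_mul, sub_mul, mul_sub, smul_mul_assoc, mul_smul_comm, mul_assoc,
      smul_add, smul_sub]
    abel
  simpa using congrFun (congrFun key i) j

/-! ### Matrix coefficients, degrees and bases. -/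

section Coefficients

variable {n : Type}

/-- The matrix coefficient of `x ^ m`. -/
def coeffMat (P : MatPoly n) (m : ℕ) : Matrix n n ℂ := P.map fun p => p.coeff m

lemma coeffMat_add (P Q : MatPoly n) (m : ℕ) :
    coeffMat (P + Q) m = coeffMat P m + coeffMat Q m := by
  ext1 i j
  simp [coeffMat]

lemma coeffMat_sub (P Q : MatPoly n) (m : ℕ) :
    coeffMat (P - Q) m = coeffMat P m - coeffMat Q m := by
  ext1 i j
  simp [coeffMat]

lemma coeffMat_matDeriv (P : MatPoly n) (m : ℕ) :
    coeffMat (matDeriv P) m = ((m : ℂ) + 1) • coeffMat P (m + 1) := by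
  ext1 i j
  simp [coeffMat, coeff_derivative, mul_comm]

lemma coeffMat_X_smul_matDeriv (P : MatPoly n) (m : ℕ) :
    coeffMat ((X : ℂ[X]) • matDeriv P) m = (m : ℂ) • coeffMat P m := by
  ext1 i j
  cases m <;> simp [coeffMat, coeff_derivative, mul_comm]

/-- All entries of `P` have degree less than `k`. -/
def DegLT (P : MatPoly n) (k : ℕ) : Prop := ∀ m, k ≤ m → coeffMat P m = 0

lemma degLT_succ_iff {P : MatPoly n} {k : ℕ} :
    DegLT P (k + 1) ↔ ∀ i j, (P i j).degree ≤ k := by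
  simp only [degree_le_iff_coeff_zero]
  constructor
  · intro h i j m hm
    exact congrFun (congrFun (h m (by exact_mod_cast hm)) i) j
  · intro h m hm
    ext1 i j
    exact h i j m (by exact_mod_cast hm)

lemma DegLT.of_succ {P : MatPoly n} {k : ℕ} (h : DegLT P (k + 1)) (h0 : coeffMat P k = 0) :
    DegLT P k := fun m hm => by
  rcases hm.eq_or_lt with rfl | hm
  · exact h0
  · exact h m hm

lemma DegLT.sub {P Q : MatPoly n} {k : ℕ} (hP : DegLT P k) (hQ : DegLT Q k) :
    DegLT (P - Q) k := fun m hm => by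
  rw [coeffMat_sub, hP m hm, hQ m hm, sub_zero]

lemma eq_zero_of_degLT_zero {P : MatPoly n} (h : DegLT P 0) : P = 0 := by
  ext i j m
  exact congrFun (congrFun (h m (Nat.zero_le _)) i) j

lemma exists_degLT [Finite n] (P : MatPoly n) : ∃ k, DegLT P k := by
  have := Fintype.ofFinite n
  refine ⟨(Finset.univ.sup fun i => Finset.univ.sup fun j => (P i j).natDegree) + 1, ?_⟩
  rw [degLT_succ_iff]
  intro i j
  refine degree_le_of_natDegree_le ?_
  exact (Finset.le_sup (f := fun j => (P i j).natDegree) (Finset.mem_univ j)).trans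
    (Finset.le_sup (f := fun i => Finset.univ.sup fun j => (P i j).natDegree) (Finset.mem_univ i))

variable [Fintype n] [DecidableEq n]

lemma coeffMat_const_mul (L : Matrix n n ℂ) (P : MatPoly n) (m : ℕ) :
    coeffMat (L.map C * P) m = L * coeffMat P m := by
  ext1 i j
  simp [coeffMat, Matrix.mul_apply]

lemma coeffMat_mul_const (P : MatPoly n) (L : Matrix n n ℂ) (m : ℕ) :
    coeffMat (P * L.map C) m = coeffMat P m * L := by
  ext1 i j
  simp [coeffMat, Matrix.mul_apply]

lemma DegLT.const_mul {P : MatPoly n} {k : ℕ} (hP : DegLT P k) (L : Matrix n n ℂ) :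
    DegLT (L.map C * P) k := fun m hm => by
  rw [coeffMat_const_mul, hP m hm, mul_zero]

/-- Matrix polynomials of degree less than `k` are combinations, with constant matrices on the
left, of any sequence of matrix polynomials with nonsingular leading coefficients. -/
lemma degLT_induction {S : ℕ → MatPoly n} (hS : ∀ k, DegLT (S k) (k + 1))
    (hlead : ∀ k, IsUnit (coeffMat (S k) k)) {p : MatPoly n → Prop} (zero : p 0)
    (add : ∀ P Q, p P → p Q → p (P + Q)) {k : ℕ}
    (basis : ∀ l < k, ∀ L : Matrix n n ℂ, p (L.map C * S l)) {P : MatPoly n} (hP : DegLT P k) :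
    p P := by
  induction k generalizing P with
  | zero => rwa [eq_zero_of_degLT_zero hP]
  | succ k ih =>
    obtain ⟨u, hu⟩ := hlead k
    have h1 : DegLT (P - (coeffMat P k * (u⁻¹ : (Matrix n n ℂ)ˣ)).map C * S k) k := by
      refine (hP.sub ((hS k).const_mul _)).of_succ ?_
      rw [coeffMat_sub, coeffMat_const_mul, ← hu, mul_assoc, Units.inv_mul, mul_one, sub_self]
    have h2 := ih (fun l hl => basis l (hl.trans (Nat.lt_succ_self k))) h1
    have h3 := add _ _ h2 (basis k (Nat.lt_succ_self k)
      (coeffMat P k * (u⁻¹ : (Matrix n n ℂ)ˣ)))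
    rwa [sub_add_cancel] at h3

/-- Nonsingular leading coefficients make the sequence a basis over constant left multipliers, which
both operators respect. -/
lemma eq_of_agree_on_basis {S : ℕ → MatPoly n} (hS : ∀ k, DegLT (S k) (k + 1))
    (hlead : ∀ k, IsUnit (coeffMat (S k) k)) {D E : RightOp n} (hD : LeftLinear D)
    (hE : LeftLinear E) (h : ∀ k, actRight (S k) D = actRight (S k) E) : D = E := by
  refine rightOp_ext fun P => ?_
  obtain ⟨k, hk⟩ := exists_degLT P
  refine degLT_induction hS hlead (p := fun P => actRight P D = actRight P E)
    (by rw [zero_actRight, zero_actRight]) ?_ ?_ hk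
  · intro P Q hP hQ
    rw [add_actRight, add_actRight, hP, hQ]
  · intro l _ L
    rw [hD, hE, h]

/-- Since x∂ acts on x^m as m and A∂ lowers degree, the coefficient of x^m is simply multiplied on
the right by em + B. -/
lemma coeffMat_firstOrder (e : ℂ) (A B : Matrix n n ℂ) (P : MatPoly n) {m : ℕ}
    (hP : DegLT P (m + 1)) :
    coeffMat (actRight P (del n * mulBy ((C e * X) • 1 + A.map C) + mulBy (B.map C))) m =
      coeffMat P m * ((e * m) • 1 + B) := by
  have h1 : matDeriv P * ((C e * X) • (1 : MatPoly n)) =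
      (e • (1 : Matrix n n ℂ)).map C * ((X : ℂ[X]) • matDeriv P) := by
    ext1 i j
    simp [Matrix.mul_apply, Matrix.one_apply, apply_ite]
    ring
  rw [actRight_add, actRight_mul, actRight_del, actRight_mulBy, actRight_mulBy, mul_add,
    coeffMat_add, coeffMat_add, coeffMat_mul_const, coeffMat_mul_const, h1, coeffMat_const_mul,
    coeffMat_X_smul_matDeriv, coeffMat_matDeriv, hP (m + 1) le_rfl]
  simp [mul_add, smul_smul, mul_comm (m : ℂ)]

lemma degLT_firstOrder (e : ℂ) (A B : Matrix n n ℂ) {P : MatPoly n} {k : ℕ}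
    (hP : DegLT P k) :
    DegLT (actRight P (del n * mulBy ((C e * X) • 1 + A.map C) + mulBy (B.map C))) k :=
  fun m hm => by
    rw [coeffMat_firstOrder _ _ _ _ fun l hl => hP l (by omega), hP m hm, zero_mul]

end Coefficients

/-! ### Action on leading coefficients and the parameter inequalities. -/

/-- The constant part of the leading coefficients of `𝒱` and `𝒩`. -/
def shiftMat (α β v : ℝ) : Matrix (Fin 2) (Fin 2) ℂ :=
  !![(((β - α) / v : ℝ) : ℂ), ((1 + (β - α) / v : ℝ) : ℂ);
     ((1 + (α - β) / v : ℝ) : ℂ), (((α - β) / v : ℝ) : ℂ)]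

/-- The diagonal entries of the constant term of `𝒱`. -/
def vDiag (α β v : ℝ) : Fin 2 → ℂ :=
  ![(((v + 2 + α + β) / 2 : ℝ) : ℂ), (((-v + 2 + α + β) / 2 : ℝ) : ℂ)]

/-- The diagonal entries of the constant term of `𝒩`. -/
def nDiag (α β v : ℝ) : Fin 2 → ℂ :=
  ![((-(-v + 4 + α + β) / 2 : ℝ) : ℂ), ((-(α + β + v + 4) / 2 : ℝ) : ℂ)]

lemma jacobiV_eq_firstOrder (α β v : ℝ) :
    jacobiV α β v = del (Fin 2) * mulBy ((C (1 : ℂ) * X) • 1 + (shiftMat α β v).map C) +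
      mulBy ((Matrix.diagonal (vDiag α β v)).map C) := by
  rw [jacobiV_eq]
  congr 3 <;> ext1 i j <;> fin_cases i <;> fin_cases j <;>
    simp [vLead, vConst, shiftMat, vDiag, rc]

lemma jacobiN_eq_firstOrder (α β v : ℝ) :
    jacobiN α β v = del (Fin 2) * mulBy ((C (-1 : ℂ) * X) • 1 + (shiftMat α β v).map C) +
      mulBy ((Matrix.diagonal (nDiag α β v)).map C) := by
  rw [jacobiN_eq]
  congr 3 <;> ext1 i j <;> fin_cases i <;> fin_cases j <;>
    simp [nLead, nConst, shiftMat, nDiag, rc]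

lemma degLT_jacobiV (α β v : ℝ) {P : MatPoly (Fin 2)} {k : ℕ} (hP : DegLT P k) :
    DegLT (actRight P (jacobiV α β v)) k := by
  rw [jacobiV_eq_firstOrder]
  exact degLT_firstOrder _ _ _ hP

lemma degLT_jacobiN (α β v : ℝ) {P : MatPoly (Fin 2)} {k : ℕ} (hP : DegLT P k) :
    DegLT (actRight P (jacobiN α β v)) k := by
  rw [jacobiN_eq_firstOrder]
  exact degLT_firstOrder _ _ _ hP

lemma isUnit_diagonal_two {d : Fin 2 → ℂ} (h : ∀ i, d i ≠ 0) :
    IsUnit (Matrix.diagonal d) := by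
  rw [Matrix.isUnit_iff_isUnit_det, Matrix.det_diagonal, isUnit_iff_ne_zero]
  exact Finset.prod_ne_zero_iff.2 fun i _ => h i

/-- The parameter conditions that the constructions use. -/
structure JacobiParams (α β v : ℝ) : Prop where
  left_lt : |α - β| < |v|
  lt_right : |v| < α + β + 2

namespace JacobiParams

variable {α β v : ℝ} (h : JacobiParams α β v)

include h

lemma ne_zero : v ≠ 0 := by
  rintro rfl
  have := h.left_lt
  rw [abs_zero] at this
  exact absurd this (not_lt.2 (abs_nonneg _))

lemma alpha : -1 < α := by
  have := abs_lt.1 (h.left_lt.trans h.lt_right)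
  linarith [this.1]

lemma beta : -1 < β := by
  have := abs_lt.1 (h.left_lt.trans h.lt_right)
  linarith [this.2]

lemma add_ne : v + α - β ≠ 0 := by
  intro h0
  have : α - β = -v := by linarith
  have h1 := h.left_lt
  rw [this, abs_neg] at h1
  exact lt_irrefl _ h1

lemma sub_ne : v - α + β ≠ 0 := by
  intro h0
  have : α - β = v := by linarith
  have h1 := h.left_lt
  rw [this] at h1
  exact lt_irrefl _ h1

lemma pos_left : 0 < v + 2 + α + β := by linarith [(abs_lt.1 h.lt_right).1]

lemma pos_right : 0 < -v + 2 + α + β := by linarith [(abs_lt.1 h.lt_right).2]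

/-- This matrix multiplies the leading coefficient of a degree-m polynomial under 𝒱; its diagonal
entries are positive because |v| < α + β + 2. -/
lemma isUnit_vDiag (m : ℕ) :
    IsUnit (((1 : ℂ) * m) • 1 + Matrix.diagonal (vDiag α β v)) := by
  have h1 := h.pos_left
  have h2 := h.pos_right
  have hm : (0 : ℝ) ≤ m := m.cast_nonneg
  have e : (((1 : ℂ) * m) • 1 + Matrix.diagonal (vDiag α β v)) =
      Matrix.diagonal fun i => (m : ℂ) + vDiag α β v i := by
    ext1 i j
    by_cases hij : i = j <;> simp [hij]
  rw [e]
  refine isUnit_diagonal_two fun i => ?_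
  fin_cases i
  · have : (m : ℝ) + (v + 2 + α + β) / 2 ≠ 0 := by positivity
    change (m : ℂ) + (((v + 2 + α + β) / 2 : ℝ) : ℂ) ≠ 0
    exact_mod_cast this
  · have : (m : ℝ) + (-v + 2 + α + β) / 2 ≠ 0 := by positivity
    change (m : ℂ) + (((-v + 2 + α + β) / 2 : ℝ) : ℂ) ≠ 0
    exact_mod_cast this

lemma isUnit_nDiag (m : ℕ) :
    IsUnit (((-1 : ℂ) * m) • 1 + Matrix.diagonal (nDiag α β v)) := by
  have h1 := h.pos_left
  have h2 := h.pos_right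
  have hm : (0 : ℝ) ≤ m := m.cast_nonneg
  have e : (((-1 : ℂ) * m) • 1 + Matrix.diagonal (nDiag α β v)) =
      Matrix.diagonal fun i => -(m : ℂ) + nDiag α β v i := by
    ext1 i j
    by_cases hij : i = j <;> simp [hij]
  rw [e]
  refine isUnit_diagonal_two fun i => ?_
  fin_cases i
  · have : -(m : ℝ) + -(-v + 4 + α + β) / 2 ≠ 0 := by
      have : -(m : ℝ) + -(-v + 4 + α + β) / 2 < 0 := by linarith
      exact this.ne
    change -(m : ℂ) + ((-(-v + 4 + α + β) / 2 : ℝ) : ℂ) ≠ 0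
    exact_mod_cast this
  · have : -(m : ℝ) + -(α + β + v + 4) / 2 ≠ 0 := by
      have : -(m : ℝ) + -(α + β + v + 4) / 2 < 0 := by linarith
      exact this.ne
    change -(m : ℂ) + ((-(α + β + v + 4) / 2 : ℝ) : ℂ) ≠ 0
    exact_mod_cast this

lemma diagWeight_ne_zero (i : Fin 2) : diagWeight α β v i ≠ 0 := by
  have h0 := h.ne_zero
  have h1 := h.add_ne
  have h2 := h.sub_ne
  have h3 := h.pos_left.ne'
  have h4 := h.pos_right.ne'
  fin_cases i
  · simp only [diagWeight]
    exact div_ne_zero (div_ne_zero (mul_ne_zero h0 h3) h1) (by norm_num)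
  · simp only [diagWeight]
    exact div_ne_zero (div_ne_zero (mul_ne_zero h0 h4) h2) (by norm_num)

/-- `𝒩` is injective on matrix polynomials. -/
lemma jacobiN_injective {P : MatPoly (Fin 2)} (hP : actRight P (jacobiN α β v) = 0) : P = 0 := by
  obtain ⟨k, hk⟩ := exists_degLT P
  induction k with
  | zero => exact eq_zero_of_degLT_zero hk
  | succ k ih =>
    refine ih (hk.of_succ ?_)
    have h1 := coeffMat_firstOrder (-1) (shiftMat α β v) (Matrix.diagonal (nDiag α β v)) P hk
    rw [← jacobiN_eq_firstOrder, hP] at h1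
    have h2 : coeffMat (0 : MatPoly (Fin 2)) k = 0 := by
      ext1 i j
      simp [coeffMat]
    rw [h2] at h1
    exact ((h.isUnit_nDiag k).mul_left_eq_zero).1 h1.symm

end JacobiParams

/-! ### Orthogonality, and the image of orthogonal polynomials under 𝒩. -/

/-- The scalar Jacobi polynomial as a matrix polynomial. -/
def jacobiMat (α β : ℝ) (m : ℕ) : MatPoly (Fin 2) := jacobiPoly α β m • 1

lemma degLT_jacobiMat (α β : ℝ) (m : ℕ) : DegLT (jacobiMat α β m) (m + 1) := by
  rw [degLT_succ_iff]
  intro i j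
  by_cases hij : i = j
  · simpa [jacobiMat, hij] using jacobiPoly_natDegree_le α β m
  · simp [jacobiMat, hij]

lemma coeffMat_jacobiMat (α β : ℝ) (m : ℕ) :
    coeffMat (jacobiMat α β m) m = (jacobiPoly α β m).coeff m • 1 := by
  ext1 i j
  by_cases hij : i = j <;> simp [coeffMat, jacobiMat, hij]

lemma isUnit_coeffMat_jacobiMat {α β : ℝ} (hα : -1 < α) (hβ : -1 < β) (m : ℕ) :
    IsUnit (coeffMat (jacobiMat α β m) m) := by
  rw [coeffMat_jacobiMat, Matrix.isUnit_iff_isUnit_det]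
  simp [jacobiPoly_coeff hα hβ m]

lemma actRight_jacobiMat_jacobiOp {α : ℝ} (hα : -1 < α) (β : ℝ) (m : ℕ) :
    actRight (jacobiMat α β m) (jacobiOp α β) = rc (jacobiEig α β m) • jacobiMat α β m := by
  rw [jacobiMat, actRight_jacobiOp, jacobiScalarOp_jacobiPoly hα, smul_smul]

lemma rPoly_eq (α β : ℝ) : rPoly α β = pearsonPoly α β + derivative qPoly := by
  refine Polynomial.funext fun x => ?_
  simp [rPoly, pearsonPoly, qPoly, rc]
  ring

/-- The Jacobi operator is symmetric. -/
lemma jacobiFunctional_symm {α β : ℝ} (hα : -1 < α) (hβ : -1 < β) (f g : ℂ[X]) :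
    jacobiFunctional α β (qPoly * (jacobiScalarOp α β f * g)) =
      jacobiFunctional α β (qPoly * (f * jacobiScalarOp α β g)) := by
  -- One integration by parts gives a Dirichlet form that is symmetric in f and g.
  have key : ∀ f g : ℂ[X], jacobiFunctional α β (qPoly * (jacobiScalarOp α β f * g)) =
      -jacobiFunctional α β (qPoly ^ 2 * (derivative f * derivative g)) := by
    intro f g
    rw [eq_neg_iff_add_eq_zero, ← jacobiFunctional_add hα hβ]
    convert jacobiFunctional_derivative hα hβ (qPoly * derivative f * g) using 2
    rw [jacobiScalarOp, rPoly_eq]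
    simp only [derivative_mul]
    ring
  rw [key, mul_comm f, key, mul_comm (derivative f)]

lemma jacobiPoly_orthogonal {α β : ℝ} (hα : -1 < α) (hβ : -1 < β) {k m : ℕ} (hkm : k ≠ m) :
    jacobiFunctional α β (qPoly * (jacobiPoly α β k * jacobiPoly α β m)) = 0 := by
  have h1 := jacobiFunctional_symm hα hβ (jacobiPoly α β k) (jacobiPoly α β m)
  rw [jacobiScalarOp_jacobiPoly hα, jacobiScalarOp_jacobiPoly hα] at h1
  have e1 : ∀ a : ℝ, qPoly * (rc a * jacobiPoly α β k * jacobiPoly α β m) =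
      C (a : ℂ) * (qPoly * (jacobiPoly α β k * jacobiPoly α β m)) := fun a => by rw [rc]; ring
  have e2 : ∀ a : ℝ, qPoly * (jacobiPoly α β k * (rc a * jacobiPoly α β m)) =
      C (a : ℂ) * (qPoly * (jacobiPoly α β k * jacobiPoly α β m)) := fun a => by rw [rc]; ring
  rw [e1, e2, jacobiFunctional_C_mul, jacobiFunctional_C_mul, ← sub_eq_zero, ← sub_mul,
    mul_eq_zero] at h1
  refine h1.resolve_left ?_
  have := sub_ne_zero.2 (jacobiEig_injective hα hβ hkm)
  exact_mod_cast this

lemma jacobiPoly_orthogonal_degLT {α β : ℝ} (hα : -1 < α) (hβ : -1 < β) {m : ℕ}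
    {R : MatPoly (Fin 2)} (hR : DegLT R m) (i j : Fin 2) :
    jacobiFunctional α β (qPoly * (jacobiPoly α β m * R i j)) = 0 := by
  refine degLT_induction (degLT_jacobiMat α β) (isUnit_coeffMat_jacobiMat hα hβ)
    (p := fun R => jacobiFunctional α β (qPoly * (jacobiPoly α β m * R i j)) = 0) ?_ ?_ ?_ hR
  · simp [jacobiFunctional_zero]
  · intro P Q hP hQ
    rw [Matrix.add_apply, mul_add, mul_add, jacobiFunctional_add hα hβ, hP, hQ, add_zero]
  · intro l hl L
    have e : qPoly * (jacobiPoly α β m * (L.map C * jacobiMat α β l) i j) =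
        C (L i j) * (qPoly * (jacobiPoly α β m * jacobiPoly α β l)) := by
      simp [jacobiMat]
      ring
    rw [e, jacobiFunctional_C_mul, jacobiPoly_orthogonal hα hβ hl.ne', mul_zero]

lemma eq_zero_of_orthogonal_degLT {α β : ℝ} (hα : -1 < α) (hβ : -1 < β) {m : ℕ}
    {P : MatPoly (Fin 2)} (hP : DegLT P m)
    (horth : ∀ R : MatPoly (Fin 2), DegLT R m → ∀ i j,
      jacobiFunctional α β (qPoly * (P * R) i j) = 0) : P = 0 := by
  ext1 i j
  refine eq_zero_of_jacobiFunctional hα hβ ?_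
  -- This test polynomial isolates |P i j|² in entry (i, 0) of the product.
  have h1 := horth (Matrix.single j 0 ((P i j).map (starRingEnd ℂ))) ?_ i 0
  · simpa using h1
  · intro l hl
    ext1 a b
    have h2 : (P i j).coeff l = 0 := congrFun (congrFun (hP l hl) i) j
    simp only [coeffMat, Matrix.map_apply, Matrix.single_apply]
    split_ifs <;> simp [h2]

lemma degLT_matStar {P : MatPoly (Fin 2)} {k : ℕ} (hP : DegLT P k) : DegLT (matStar P) k :=
  fun m hm => by
    ext1 i j
    have : (P j i).coeff m = 0 := congrFun (congrFun (hP m hm) j) i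
    simp [coeffMat, matStar, this]

lemma matStar_matStar (P : MatPoly (Fin 2)) : matStar (matStar P) = P := by
  ext i j m
  simp [matStar]

lemma matStar_const (L : Matrix (Fin 2) (Fin 2) ℂ) :
    matStar (L.map C) = L.conjTranspose.map C := by
  ext1 i j
  simp [matStar]

lemma jacobiFunctional_sum_mul_const {α β : ℝ} (hα : -1 < α) (hβ : -1 < β)
    (P : MatPoly (Fin 2)) (L : Matrix (Fin 2) (Fin 2) ℂ) (i j : Fin 2) :
    jacobiFunctional α β ((P * L.map C) i j) =
      ∑ k, jacobiFunctional α β (P i k) * L k j := by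
  simp only [Matrix.mul_apply, Fin.sum_univ_two, Matrix.map_apply]
  rw [jacobiFunctional_add hα hβ, mul_comm (P i 0), mul_comm (P i 1), jacobiFunctional_C_mul,
    jacobiFunctional_C_mul]
  ring

namespace JacobiParams

variable {α β v : ℝ} (h : JacobiParams α β v)

include h

/-- An orthogonal sequence for `W` is orthogonal to all polynomials of lower degree. -/
lemma orthogonal_degLT {Q : ℕ → MatPoly (Fin 2)}
    (hQ : IsOrthogonalSeq (Set.Ioo (-1 : ℝ) 1) (jacobiWeight α β v) Q) {m : ℕ}
    {R : MatPoly (Fin 2)} (hR : DegLT R m) (i j : Fin 2) :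
    jacobiFunctional α β ((Q m * weightPoly α β v * matStar R) i j) = 0 := by
  have hdeg : ∀ k, DegLT (Q k) (k + 1) := fun k => degLT_succ_iff.2 (hQ.degree_le k)
  refine degLT_induction hdeg hQ.leading (p := fun R => ∀ i j,
    jacobiFunctional α β ((Q m * weightPoly α β v * matStar R) i j) = 0) ?_ ?_ ?_ hR i j
  · intro i j
    simp [matStar, jacobiFunctional_zero, Matrix.mul_apply]
  · intro P Q h1 h2 i j
    rw [matStar_add, mul_add, Matrix.add_apply, jacobiFunctional_add h.alpha h.beta, h1, h2,
      add_zero]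
  · intro l hl L i j
    rw [matStar_mul, matStar_const, ← mul_assoc,
      jacobiFunctional_sum_mul_const h.alpha h.beta]
    refine Finset.sum_eq_zero fun k _ => ?_
    rw [← matInner_jacobiWeight h.ne_zero h.add_ne h.sub_ne, hQ.orthogonal m l hl.ne',
      Matrix.zero_apply, zero_mul]

/-- `𝒩` maps orthogonal polynomials for `W` to multiples of scalar Jacobi polynomials. -/
lemma exists_actRight_jacobiN {Q : ℕ → MatPoly (Fin 2)}
    (hQ : IsOrthogonalSeq (Set.Ioo (-1 : ℝ) 1) (jacobiWeight α β v) Q) (m : ℕ) :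
    ∃ A : Matrix (Fin 2) (Fin 2) ℂ, IsUnit A ∧
      actRight (Q m) (jacobiN α β v) = A.map C * jacobiMat α β m := by
  have hdeg : DegLT (Q m) (m + 1) := degLT_succ_iff.2 (hQ.degree_le m)
  have hdN := degLT_jacobiN α β v hdeg
  set c := (jacobiPoly α β m).coeff m with hc
  have hc0 : c ≠ 0 := jacobiPoly_coeff h.alpha h.beta m
  set P := actRight (Q m) (jacobiN α β v) with hP
  have hlead : coeffMat P m =
      coeffMat (Q m) m * (((-1 : ℂ) * m) • 1 + Matrix.diagonal (nDiag α β v)) := by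
    rw [hP, jacobiN_eq_firstOrder, coeffMat_firstOrder _ _ _ _ hdeg]
  have hunit : IsUnit (coeffMat P m) := by
    rw [hlead]
    exact (hQ.leading m).mul (h.isUnit_nDiag m)
  -- This constant matches the coefficients of x^m, so the difference has degree below m; it remains
  -- to show it orthogonal to all lower degrees.
  refine ⟨c⁻¹ • coeffMat P m, ?_, ?_⟩
  · rw [Matrix.isUnit_iff_isUnit_det] at hunit ⊢
    rw [Matrix.det_smul]
    exact (IsUnit.mk0 _ (pow_ne_zero _ (inv_ne_zero hc0))).mul hunit
  · rw [← sub_eq_zero]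
    refine eq_zero_of_orthogonal_degLT h.alpha h.beta (m := m) ?_ ?_
    · refine (hdN.sub ((degLT_jacobiMat α β m).const_mul _)).of_succ ?_
      rw [coeffMat_sub, coeffMat_const_mul, coeffMat_jacobiMat, ← hc, sub_eq_zero]
      simp [smul_smul, hc0]
    · intro R hR i j
      set K : MatPoly (Fin 2) := Matrix.diagonal (fun i => rc (diagWeight α β v i)) with hK
      set K' : Matrix (Fin 2) (Fin 2) ℂ :=
        Matrix.diagonal (fun i => ((diagWeight α β v i : ℂ))⁻¹) with hK'
      have hKK : K * K'.map C = 1 := by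
        ext1 a b
        have := h.diagWeight_ne_zero a
        by_cases hab : a = b
        · subst hab
          simp [hK, hK', rc, ← C_mul, this]
        · simp [hK, hK', hab]
      -- The factor K⁻¹ in the test polynomial cancels the weight K. As 𝒱 does not raise degrees,
      -- the left side of the adjoint relation vanishes.
      have h1 := jacobiFunctional_adjoint h.alpha h.beta h.ne_zero h.add_ne h.sub_ne (Q m)
        (matStar (K'.map C * R)) i j
      rw [h.orthogonal_degLT hQ (degLT_jacobiV α β v (degLT_matStar (hR.const_mul K'))),
        matStar_matStar, ← hP, ← hK, mul_assoc P, ← mul_assoc K, hKK, one_mul, eq_comm,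
        neg_eq_zero] at h1
      have e : qPoly * ((P - (c⁻¹ • coeffMat P m).map C * jacobiMat α β m) * R) i j =
          (qPoly • (P * R)) i j + -(qPoly * (jacobiPoly α β m *
            ((c⁻¹ • coeffMat P m).map C * R) i j)) := by
        rw [sub_mul, Matrix.sub_apply, jacobiMat, mul_smul_comm, mul_one, smul_mul_assoc,
          Matrix.smul_apply, Matrix.smul_apply, smul_eq_mul, smul_eq_mul]
        ring
      rw [e, jacobiFunctional_add h.alpha h.beta, h1, jacobiFunctional_neg,
        jacobiPoly_orthogonal_degLT h.alpha h.beta (hR.const_mul _)]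
      simp

end JacobiParams

/-! ### Operators commuting with the Jacobi operator. -/

lemma qPoly_ne_zero : qPoly ≠ 0 := by
  intro h
  have := congrArg (eval 0) h
  simp [qPoly] at this

/-- The leading coefficient equation of operators commuting with a Jacobi operator. -/
lemma eq_of_leading_equation (k : ℕ) {g : ℂ[X]}
    (hg : 2 * qPoly * derivative g = (k : ℂ[X]) * derivative qPoly * g) :
    (Even k → ∃ c : ℂ, g = C c * qPoly ^ (k / 2)) ∧ (¬Even k → g = 0) := by
  have hq' : derivative qPoly = -2 * X := by
    simp [qPoly]
    norm_num
  have hq0 := qPoly_ne_zero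
  -- As q is coprime to q' = -2x, it divides g; the quotient satisfies the same equation with k - 2
  -- in place of k.
  have hfac : ∀ k : ℕ, ∀ g : ℂ[X], k ≠ 0 →
      2 * qPoly * derivative g = (k : ℂ[X]) * derivative qPoly * g →
      ∃ f, g = qPoly * f ∧
        2 * qPoly * derivative f + 2 * derivative qPoly * f = (k : ℂ[X]) * derivative qPoly * f := by
    intro k g hk hg
    have h1 : qPoly ∣ X * g := by
      have hk' : (k : ℂ) ≠ 0 := by exact_mod_cast hk
      refine ⟨C (-(k : ℂ)⁻¹) * derivative g, ?_⟩
      have h2 : C ((k : ℂ)⁻¹) * (k : ℂ[X]) = 1 := by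
        rw [← C_eq_natCast, ← C_mul, inv_mul_cancel₀ hk', C_1]
      rw [hq'] at hg
      have h3 : (2 : ℂ[X]) * (X * g) = 2 * (qPoly * (C (-(k : ℂ)⁻¹) * derivative g)) := by
        rw [C_neg]
        linear_combination (-2 * X * g) * h2 + C ((k : ℂ)⁻¹) * hg
      exact mul_left_cancel₀ two_ne_zero h3
    have hcop : IsCoprime qPoly X := ⟨1, X, by rw [qPoly]; ring⟩
    obtain ⟨f, rfl⟩ := hcop.dvd_of_dvd_mul_left h1
    refine ⟨f, rfl, ?_⟩
    refine mul_left_cancel₀ hq0 ?_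
    rw [derivative_mul] at hg
    linear_combination hg
  induction k using Nat.twoStepInduction generalizing g with
  | zero =>
    refine ⟨fun _ => ?_, fun h => absurd Even.zero h⟩
    have h1 : derivative g = 0 := by
      have : 2 * qPoly * derivative g = 0 := by simpa using hg
      exact (mul_eq_zero.1 this).resolve_left (mul_ne_zero two_ne_zero hq0)
    exact ⟨g.coeff 0, by simpa using eq_C_of_derivative_eq_zero h1⟩
  | one =>
    refine ⟨fun h => absurd h (by decide), fun _ => ?_⟩
    obtain ⟨f, rfl, hf⟩ := hfac 1 g one_ne_zero hg
    suffices f = 0 by rw [this, mul_zero]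
    by_contra hf0
    -- With d the degree of f, the coefficient of degree d + 1 is 0 on the left and (d + 1) times
    -- the leading coefficient on the right.
    have h1 : derivative f = X * (X * derivative f + f) := by
      have : (2 : ℂ[X]) * derivative f = 2 * (X * (X * derivative f + f)) := by
        rw [hq', qPoly] at hf
        push_cast at hf
        linear_combination hf
      exact mul_left_cancel₀ two_ne_zero this
    have h2 := congrArg (fun p => p.coeff (f.natDegree + 1)) h1
    have h3 : (X * derivative f).coeff f.natDegree = f.natDegree * f.leadingCoeff := by
      cases hd : f.natDegree with
      | zero => simp
      | succ d => simp [coeff_derivative, leadingCoeff, hd, mul_comm]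
    simp only [coeff_X_mul, coeff_add, h3, coeff_derivative] at h2
    rw [coeff_eq_zero_of_natDegree_lt (by omega), zero_mul, coeff_natDegree] at h2
    have h4 : ((f.natDegree : ℂ) + 1) * f.leadingCoeff = 0 := by linear_combination -h2
    rcases mul_eq_zero.1 h4 with h5 | h5
    · exact absurd h5 (Nat.cast_add_one_ne_zero _)
    · exact hf0 (leadingCoeff_eq_zero.1 h5)
  | more k ih _ =>
    obtain ⟨f, rfl, hf⟩ := hfac (k + 2) g (by omega) hg
    have h1 := @ih f (by push_cast at hf; linear_combination hf)
    have h2 : Even (k + 2) ↔ Even k := by simp [Nat.even_add]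
    rw [h2]
    refine ⟨fun hk => ?_, fun hk => by rw [h1.2 hk, mul_zero]⟩
    obtain ⟨c, hc⟩ := h1.1 hk
    refine ⟨c, ?_⟩
    rw [hc, Nat.add_div_right k two_pos, pow_succ]
    ring

/-- The leading coefficient of an operator commuting with the Jacobi operator. -/
lemma HasTop.leading_of_commute {α β : ℝ} {D : RightOp (Fin 2)} {k : ℕ} {G : MatPoly (Fin 2)}
    (h : HasTop D k G) (hD : Commute D (jacobiOp α β)) :
    (Even k → ∃ M : Matrix (Fin 2) (Fin 2) ℂ, G = qPoly ^ (k / 2) • M.map C) ∧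
      (¬Even k → G = 0) := by
  have h1 := h.of_commute hD
  have h2 : ∀ i j, 2 * qPoly * derivative (G i j) =
      (k : ℂ[X]) * derivative qPoly * G i j := fun i j => by
    simpa using congrFun (congrFun h1 i) j
  refine ⟨fun hk => ?_, fun hk => ?_⟩
  · choose c hc using fun i j => (eq_of_leading_equation k (h2 i j)).1 hk
    refine ⟨Matrix.of c, ?_⟩
    ext1 i j
    rw [hc i j]
    simp [mul_comm]
  · ext1 i j
    exact (eq_of_leading_equation k (h2 i j)).2 hk

lemma matDeriv_const (L : Matrix (Fin 2) (Fin 2) ℂ) : matDeriv (L.map C) = 0 := by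
  ext1 i j
  simp

lemma commute_mulBy_const_jacobiOp (α β : ℝ) (L : Matrix (Fin 2) (Fin 2) ℂ) :
    Commute (mulBy (L.map C)) (jacobiOp α β) := by
  refine rightOp_ext fun P => ?_
  rw [actRight_mul, actRight_mul, jacobiOp, actRight_scalarOp, actRight_scalarOp, actRight_mulBy,
    actRight_mulBy, matDeriv_mul, matDeriv_const, mul_zero, add_zero, matDeriv_mul, matDeriv_const,
    mul_zero, add_zero, add_mul, smul_mul_assoc, smul_mul_assoc]

lemma hasTop_mulBy (F : MatPoly (Fin 2)) : HasTop (mulBy F) 0 F := by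
  simp [HasTop]

lemma hasTop_firstOrder (A B : MatPoly (Fin 2)) :
    HasTop (del (Fin 2) * mulBy A + mulBy B) 1 A := by
  rw [HasTop, pow_one, add_sub_cancel_left]
  exact mulBy_mem one_pos B

lemma hasTop_jacobiOp (α β : ℝ) : HasTop (jacobiOp α β) 2 (qPoly • 1) := by
  rw [HasTop, jacobiOp, scalarOp, add_sub_cancel_left]
  simpa using monomial_mem (n := Fin 2) one_lt_two (rPoly α β • 1)

lemma hasTop_jacobiOp_pow (α β : ℝ) (k : ℕ) :
    HasTop (jacobiOp α β ^ k) (2 * k) (qPoly ^ k • 1) := by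
  induction k with
  | zero =>
    rw [pow_zero, pow_zero, one_smul, ← mulBy_one]
    exact hasTop_mulBy 1
  | succ k ih =>
    have := ih.mul (hasTop_jacobiOp α β)
    rw [pow_succ, pow_succ, mul_add, mul_one]
    convert this using 1
    rw [smul_mul_smul_comm, one_mul]

lemma map_smul_one (a : ℂ) :
    (a • (1 : Matrix (Fin 2) (Fin 2) ℂ)).map C = C a • (1 : MatPoly (Fin 2)) := by
  ext1 i j
  by_cases hij : i = j <;> simp [hij]

/-! ### The algebra 𝒟(W) and its intertwining with the commutant of the Jacobi operator. -/

/-- The elements of `𝒟(W)` form a subalgebra. -/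
def opSubalgebra (s : Set ℝ) (W : ℝ → Matrix (Fin 2) (Fin 2) ℂ) :
    Subalgebra ℂ (RightOp (Fin 2)) where
  carrier := opAlgebra s W
  mul_mem' := by
    rintro D E ⟨hD, hD'⟩ ⟨hE, hE'⟩
    rw [mem_matOmega_iff] at hD hE
    obtain ⟨k, hk⟩ := hD
    obtain ⟨l, hl⟩ := hE
    refine ⟨mem_matOmega_iff.2 ⟨_, mul_mem_orderLT (orderLT_mono (Nat.le_succ k) hk) hl⟩, ?_⟩
    intro Q hQ m
    obtain ⟨L, hL⟩ := hD' Q hQ m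
    obtain ⟨M, hM⟩ := hE' Q hQ m
    refine ⟨L * M, ?_⟩
    rw [actRight_mul, hL, leftLinear_of_mem hl, hM, ← mul_assoc, Matrix.map_mul]
  add_mem' := by
    rintro D E ⟨hD, hD'⟩ ⟨hE, hE'⟩
    rw [mem_matOmega_iff] at hD hE
    obtain ⟨k, hk⟩ := hD
    obtain ⟨l, hl⟩ := hE
    refine ⟨mem_matOmega_iff.2 ⟨max k l, add_mem (orderLT_mono (le_max_left k l) hk)
      (orderLT_mono (le_max_right k l) hl)⟩, ?_⟩
    intro Q hQ m
    obtain ⟨L, hL⟩ := hD' Q hQ m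
    obtain ⟨M, hM⟩ := hE' Q hQ m
    refine ⟨L + M, ?_⟩
    rw [actRight_add, hL, hM, Matrix.map_add _ (map_add C), add_mul]
  algebraMap_mem' a := by
    have e : algebraMap ℂ (RightOp (Fin 2)) a =
        mulBy ((a • (1 : Matrix (Fin 2) (Fin 2) ℂ)).map C) := by
      refine rightOp_ext fun P => ?_
      rw [Algebra.algebraMap_eq_smul_one, actRight_smul, actRight_one, actRight_mulBy,
        map_smul_one, mul_smul_comm, mul_one]
      ext1 i j
      simp [smul_eq_C_mul]
    rw [e]
    refine ⟨mem_matOmega_iff.2 ⟨1, mulBy_mem one_pos _⟩, fun Q _ m =>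
      ⟨a • (1 : Matrix (Fin 2) (Fin 2) ℂ), ?_⟩⟩
    rw [actRight_mulBy, map_smul_one, mul_smul_comm, mul_one, smul_mul_assoc, one_mul]

lemma jacobiV_mem (α β v : ℝ) : jacobiV α β v ∈ orderLT (Fin 2) 2 :=
  (hasTop_firstOrder _ _).mem

lemma jacobiN_mem (α β v : ℝ) : jacobiN α β v ∈ orderLT (Fin 2) 2 :=
  (hasTop_firstOrder _ _).mem

/-- The eigenvalue of `𝒱𝒩` on the Jacobi polynomial of degree `m`. -/
def vnEig (α β v : ℝ) (m : ℕ) : Matrix (Fin 2) (Fin 2) ℂ :=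
  Matrix.diagonal fun i => ((jacobiEig α β m - jacobiShift α β v i : ℝ) : ℂ)

namespace JacobiParams

variable {α β v : ℝ} (h : JacobiParams α β v)

include h

lemma actRight_jacobiMat_vn (m : ℕ) :
    actRight (actRight (jacobiMat α β m) (jacobiV α β v)) (jacobiN α β v) =
      (vnEig α β v m).map C * jacobiMat α β m := by
  rw [← actRight_mul, jacobiV_mul_jacobiN h.ne_zero, actRight_sub,
    actRight_jacobiMat_jacobiOp h.alpha, actRight_mulBy]
  ext1 i j
  by_cases hij : i = j
  · subst hij
    simp [jacobiMat, vnEig, rc]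
    ring
  · simp [jacobiMat, vnEig, hij]

/-- `𝒱` maps the scalar Jacobi polynomials to multiples of orthogonal polynomials for `W`. -/
lemma exists_actRight_jacobiV {Q : ℕ → MatPoly (Fin 2)}
    (hQ : IsOrthogonalSeq (Set.Ioo (-1 : ℝ) 1) (jacobiWeight α β v) Q) (m : ℕ) :
    ∃ B : Matrix (Fin 2) (Fin 2) ℂ,
      actRight (jacobiMat α β m) (jacobiV α β v) = B.map C * Q m := by
  obtain ⟨A, hA, hN⟩ := h.exists_actRight_jacobiN hQ m
  obtain ⟨u, rfl⟩ := hA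
  -- The witness is forced by applying 𝒩: the left side becomes the 𝒱𝒩-eigenvalue times P_m, the
  -- right side B A P_m. Injectivity of 𝒩 does the rest.
  refine ⟨vnEig α β v m * (u⁻¹ : (Matrix (Fin 2) (Fin 2) ℂ)ˣ), ?_⟩
  rw [← sub_eq_zero]
  refine h.jacobiN_injective ?_
  rw [sub_actRight, h.actRight_jacobiMat_vn, leftLinear_of_mem (jacobiN_mem α β v), hN,
    ← mul_assoc, ← Matrix.map_mul, mul_assoc (vnEig α β v m), Units.inv_mul, mul_one, sub_self]

/-- `P_m · 𝒱` is a sequence of orthogonal polynomials for `W`. -/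
lemma isOrthogonalSeq :
    IsOrthogonalSeq (Set.Ioo (-1 : ℝ) 1) (jacobiWeight α β v)
      (fun m => actRight (jacobiMat α β m) (jacobiV α β v)) where
  degree_le m := degLT_succ_iff.1 (degLT_jacobiV α β v (degLT_jacobiMat α β m))
  leading m := by
    change IsUnit (coeffMat (actRight (jacobiMat α β m) (jacobiV α β v)) m)
    rw [jacobiV_eq_firstOrder, coeffMat_firstOrder _ _ _ _ (degLT_jacobiMat α β m)]
    exact (isUnit_coeffMat_jacobiMat h.alpha h.beta m).mul (h.isUnit_vDiag m)
  orthogonal k l hkl := by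
    ext1 i j
    rw [matInner_jacobiWeight h.ne_zero h.add_ne h.sub_ne,
      jacobiFunctional_adjoint h.alpha h.beta h.ne_zero h.add_ne h.sub_ne,
      h.actRight_jacobiMat_vn, Matrix.zero_apply, neg_eq_zero]
    have hs : matStar (jacobiMat α β l) = jacobiMat α β l := by
      ext1 a b
      by_cases hab : a = b
      · simp [matStar, jacobiMat, map_conj_jacobiPoly, hab]
      · simp [matStar, jacobiMat, hab, Ne.symm hab]
    have e : (qPoly • ((vnEig α β v k).map C * jacobiMat α β k *
        (Matrix.diagonal fun i => rc (diagWeight α β v i)) * matStar (jacobiMat α β l))) i j =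
        C (vnEig α β v k i j * diagWeight α β v j) *
          (qPoly * (jacobiPoly α β k * jacobiPoly α β l)) := by
      rw [hs]
      simp only [jacobiMat, Matrix.smul_apply, mul_smul_comm, mul_one, smul_mul_assoc,
        Matrix.mul_diagonal, Matrix.map_apply, smul_eq_mul, C_mul, rc]
      ring
    rw [e, jacobiFunctional_C_mul, jacobiPoly_orthogonal h.alpha h.beta hkl, mul_zero]

/-- The round trip is Q_m ↦ A P_m ↦ A E P_m ↦ A E B Q_m; constant matrices commute with P_m because
it is a scalar polynomial times I. -/
lemma jacobiD_mem (i j : Fin 2) :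
    jacobiD α β v i j ∈ opAlgebra (Set.Ioo (-1 : ℝ) 1) (jacobiWeight α β v) := by
  refine ⟨mem_matOmega_iff.2 ⟨_, mul_mem_orderLT (k := 1) (l := 2)
    (mul_mulBy_mem (jacobiN_mem α β v) _) (jacobiV_mem α β v)⟩, fun Q hQ m => ?_⟩
  obtain ⟨A, -, hA⟩ := h.exists_actRight_jacobiN hQ m
  obtain ⟨B, hB⟩ := h.exists_actRight_jacobiV hQ m
  refine ⟨A * Matrix.single i j 1 * B, ?_⟩
  have e : A.map C * jacobiMat α β m * Matrix.single i j 1 =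
      (A * Matrix.single i j 1).map C * jacobiMat α β m := by
    rw [jacobiMat, mul_smul_comm, mul_one, mul_smul_comm, mul_one, smul_mul_assoc, Matrix.map_mul]
    congr 2
    ext1 a b
    simp [Matrix.single_apply, apply_ite]
  rw [jacobiD, actRight_mul, actRight_mul, hA, actRight_mulBy, e,
    leftLinear_of_mem (jacobiV_mem α β v), hB, ← mul_assoc, ← Matrix.map_mul]

lemma adjoin_le :
    Algebra.adjoin ℂ ({1, jacobiD α β v 0 0, jacobiD α β v 0 1, jacobiD α β v 1 0,
      jacobiD α β v 1 1} : Set (RightOp (Fin 2))) ≤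
      opSubalgebra (Set.Ioo (-1 : ℝ) 1) (jacobiWeight α β v) := by
  refine Algebra.adjoin_le ?_
  rintro D (rfl | rfl | rfl | rfl | rfl)
  · exact one_mem _
  all_goals exact h.jacobiD_mem _ _

/-- `𝒱 D 𝒩` commutes with the Jacobi operator for `D` in `𝒟(W)`. -/
lemma commute_of_mem {D : RightOp (Fin 2)}
    (hD : D ∈ opAlgebra (Set.Ioo (-1 : ℝ) 1) (jacobiWeight α β v)) :
    Commute (jacobiV α β v * D * jacobiN α β v) (jacobiOp α β) := by
  obtain ⟨k, hk⟩ := mem_matOmega_iff.1 hD.1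
  have lD := leftLinear_of_mem hk
  have lV := leftLinear_of_mem (jacobiV_mem α β v)
  have lN := leftLinear_of_mem (jacobiN_mem α β v)
  have lJ := leftLinear_of_mem (hasTop_jacobiOp α β).mem
  have lU := (lV.mul lD).mul lN
  refine eq_of_agree_on_basis (degLT_jacobiMat α β) (isUnit_coeffMat_jacobiMat h.alpha h.beta)
    (lU.mul lJ) (lJ.mul lU) fun m => ?_
  obtain ⟨L, hL⟩ := hD.2 _ h.isOrthogonalSeq m
  have hU : actRight (jacobiMat α β m) (jacobiV α β v * D * jacobiN α β v) =
      (L * vnEig α β v m).map C * jacobiMat α β m := by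
    rw [actRight_mul, actRight_mul, hL, lN, h.actRight_jacobiMat_vn, ← mul_assoc, ← Matrix.map_mul]
  -- The eigenvalue of δ is a scalar matrix, so it commutes with that of 𝒱D𝒩.
  have hJ : actRight (jacobiMat α β m) (jacobiOp α β) =
      (((jacobiEig α β m : ℂ)) • (1 : Matrix (Fin 2) (Fin 2) ℂ)).map C * jacobiMat α β m := by
    rw [actRight_jacobiMat_jacobiOp h.alpha]
    ext1 i j
    simp [Matrix.mul_apply, Matrix.one_apply, apply_ite, rc]
  rw [actRight_mul, hU, lJ, hJ, actRight_mul, hJ, lU, hU, ← mul_assoc, ← mul_assoc,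
    ← Matrix.map_mul, ← Matrix.map_mul]
  simp

end JacobiParams

/-! ### Parity of orders, operators of order zero, and generation. -/

lemma qPoly_smul_cancel {k : ℕ} {A B : MatPoly (Fin 2)} (h : qPoly ^ k • A = qPoly ^ k • B) :
    A = B := by
  ext1 i j
  exact mul_left_cancel₀ (pow_ne_zero k qPoly_ne_zero) (congrFun (congrFun h i) j)

lemma eq_zero_of_qPoly_mul_eq {g : ℂ[X]} {a b : ℂ} (h : qPoly * g = C a * X + C b) :
    g = 0 ∧ a = 0 := by
  have hg : g = 0 := by
    by_contra hg
    have hq : qPoly.natDegree = 2 := by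
      rw [qPoly, natDegree_sub_eq_right_of_natDegree_lt] <;> simp
    have h1 : (qPoly * g).natDegree = 2 + g.natDegree := by
      rw [natDegree_mul qPoly_ne_zero hg, hq]
    have h2 := natDegree_linear_le (a := a) (b := b)
    rw [← h, h1] at h2
    omega
  refine ⟨hg, ?_⟩
  have := congrArg (fun p => p.coeff 1) h
  simpa [hg, coeff_C] using this.symm

lemma matMap_eq_sum_single (M : Matrix (Fin 2) (Fin 2) ℂ) :
    (M.map C : MatPoly (Fin 2)) = M 0 0 • Matrix.single 0 0 1 + M 0 1 • Matrix.single 0 1 1 +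
      M 1 0 • Matrix.single 1 0 1 + M 1 1 • Matrix.single 1 1 1 := by
  ext1 i j
  fin_cases i <;> fin_cases j <;> simp [smul_eq_C_mul]

lemma single_eq_map (i j : Fin 2) :
    (Matrix.single i j 1 : MatPoly (Fin 2)) =
      (Matrix.single i j (1 : ℂ)).map C := by
  ext1 a b
  simp [Matrix.single_apply, apply_ite]

lemma neg_X_smul_add_mul_mul (S M : MatPoly (Fin 2)) :
    ((-X : ℂ[X]) • 1 + S) * M * ((X : ℂ[X]) • 1 + S) =
      (X : ℂ[X]) • (S * M - M * S) + S * M * S - (X ^ 2 : ℂ[X]) • M := by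
  ext1 i j
  fin_cases i <;> fin_cases j <;> simp [Matrix.mul_apply, Fin.sum_univ_two] <;> ring

/-- Multiplying out the leading coefficients of `𝒱` and `𝒩`. -/
lemma qPoly_smul_of_vLead_mul {α β v : ℝ} (hv : v ≠ 0) {G H : MatPoly (Fin 2)}
    (h : vLead α β v * G * nLead α β v = H) :
    qPoly ^ 2 • G = nLead α β v * H * vLead α β v := by
  have e : nLead α β v * (vLead α β v * G * nLead α β v) * vLead α β v =
      (nLead α β v * vLead α β v) * G * (nLead α β v * vLead α β v) := by
    simp only [mul_assoc]
  rw [← h, e, nLead_mul_vLead hv]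
  simp [smul_smul, pow_two]

lemma hasTop_vdn {α β v : ℝ} {D : RightOp (Fin 2)} {m : ℕ} {G : MatPoly (Fin 2)}
    (h : HasTop D m G) :
    HasTop (jacobiV α β v * D * jacobiN α β v) (m + 2) (vLead α β v * G * nLead α β v) := by
  have := ((hasTop_firstOrder (vLead α β v) (vConst α β v)).mul h).mul
    (hasTop_firstOrder (nLead α β v) (nConst α β v))
  rwa [add_comm 1 m] at this

/-- Multiplying the second-order coefficient by those of 𝒱 and 𝒩 on the two sides gives q² times a
matrix unit, which is nonzero. -/
lemma hasOrder_jacobiD {α β v : ℝ} (hv : v ≠ 0) (i j : Fin 2) :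
    HasOrder (jacobiD α β v i j) 2 := by
  rw [jacobiD_eq]
  set A := nLead α β v * Matrix.single i j 1 * vLead α β v with hA
  set B := -Matrix.single i j 1 * vLead α β v + nLead α β v * Matrix.single i j 1 * vConst α β v +
    nConst α β v * Matrix.single i j 1 * vLead α β v
  set F := nConst α β v * Matrix.single i j 1 * vConst α β v
  refine ⟨fun k => if k = 0 then F else if k = 1 then B else A, ?_, ?_⟩
  · simp only [diffOp, Finset.sum_range_succ, Finset.sum_range_zero]
    simp
    abel
  · intro h0
    have hA0 : A = 0 := by simpa using h0
    have h1 : vLead α β v * A * nLead α β v =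
        (vLead α β v * nLead α β v) * Matrix.single i j 1 * (vLead α β v * nLead α β v) := by
      rw [hA]
      simp only [mul_assoc]
    rw [hA0, vLead_mul_nLead hv] at h1
    have h2 : qPoly ^ 2 • (Matrix.single i j 1 : MatPoly (Fin 2)) = qPoly ^ 2 • 0 := by
      simpa [smul_smul, pow_two] using h1.symm
    have h3 := congrFun (congrFun (qPoly_smul_cancel h2) i) j
    simp at h3

/-- The first-order coefficient of `𝒱 M 𝒩 - M δ` vanishes if `𝒱 M 𝒩` commutes with `δ`. -/
lemma first_order_coeff_eq_zero {α β v : ℝ} {M : Matrix (Fin 2) (Fin 2) ℂ}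
    (hM' : vLead α β v * M.map C * nLead α β v = qPoly • M.map C)
    (hcomm : Commute (jacobiV α β v * mulBy (M.map C) * jacobiN α β v) (jacobiOp α β)) :
    M.map C * nLead α β v + vLead α β v * M.map C * nConst α β v +
      vConst α β v * M.map C * nLead α β v - rPoly α β • M.map C = 0 := by
  have hvF : matDeriv (vLead α β v * M.map C) = M.map C := by
    rw [matDeriv_mul, matDeriv_vLead, matDeriv_const, one_mul, mul_zero, add_zero]
  -- The second-order terms cancel, leaving a first-order operator that commutes with δ. The odd
  -- order forces its leading coefficient to vanish.
  have hU : jacobiV α β v * mulBy (M.map C) * jacobiN α β v - mulBy (M.map C) * jacobiOp α β =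
      del (Fin 2) * mulBy (M.map C * nLead α β v + vLead α β v * M.map C * nConst α β v +
        vConst α β v * M.map C * nLead α β v - rPoly α β • M.map C) +
      mulBy (matDeriv (vConst α β v * M.map C) * nLead α β v +
        vConst α β v * M.map C * nConst α β v) := by
    have hJ : jacobiOp α β * mulBy (M.map C) = del (Fin 2) ^ 2 * mulBy (qPoly • M.map C) +
        del (Fin 2) * mulBy (rPoly α β • M.map C) := by
      rw [jacobiOp, scalarOp, add_mul, mul_assoc, mul_assoc, mulBy_mul, mulBy_mul,
        smul_mul_assoc, smul_mul_assoc, one_mul]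
    rw [(commute_mulBy_const_jacobiOp α β M).eq, hJ, jacobiV_eq, jacobiN_eq,
      firstOrder_mul_mulBy, firstOrder_mul, hM', hvF, mulBy_sub, mul_sub]
    abel
  have hcomm' : Commute (jacobiV α β v * mulBy (M.map C) * jacobiN α β v -
      mulBy (M.map C) * jacobiOp α β) (jacobiOp α β) :=
    hcomm.sub_left ((commute_mulBy_const_jacobiOp α β M).mul_left (Commute.refl _))
  exact ((hU ▸ hasTop_firstOrder _ _ : HasTop (jacobiV α β v * mulBy (M.map C) *
    jacobiN α β v - mulBy (M.map C) * jacobiOp α β) 1 _).leading_of_commute hcomm').2 (by decide)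

namespace JacobiParams

variable {α β v : ℝ} (h : JacobiParams α β v)

include h

/-- Passing to 𝒱D𝒩 shifts the order by two and keeps the parity, and its leading coefficient
determines G up to the factor q². -/
lemma even_of_hasTop {D : RightOp (Fin 2)}
    (hD : D ∈ opAlgebra (Set.Ioo (-1 : ℝ) 1) (jacobiWeight α β v)) {m : ℕ} {G : MatPoly (Fin 2)}
    (hG : HasTop D m G) (hm : ¬Even m) : G = 0 := by
  have h1 := ((hasTop_vdn hG).leading_of_commute (h.commute_of_mem hD)).2
    (by simpa [Nat.even_add] using hm)
  have h2 := qPoly_smul_of_vLead_mul h.ne_zero h1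
  refine qPoly_smul_cancel (k := 2) ?_
  rw [h2]
  simp

/-- The operators of order zero in `𝒟(W)` are the scalars. -/
lemma eq_smul_one_of_mulBy_mem {F : MatPoly (Fin 2)}
    (hF : mulBy F ∈ opAlgebra (Set.Ioo (-1 : ℝ) 1) (jacobiWeight α β v)) :
    ∃ z : ℂ, mulBy F = z • (1 : RightOp (Fin 2)) := by
  have hcomm := h.commute_of_mem hF
  obtain ⟨M, hM⟩ := ((hasTop_vdn (hasTop_mulBy F)).leading_of_commute hcomm).1 even_two
  have hM' : vLead α β v * F * nLead α β v = qPoly • M.map C := by simpa using hM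
  have h1 := qPoly_smul_of_vLead_mul h.ne_zero hM'
  have h2 : qPoly • F = nLead α β v * M.map C * vLead α β v := by
    refine qPoly_smul_cancel (k := 1) ?_
    rw [pow_one, smul_smul, ← pow_two, h1]
    simp
  set S := shiftMat α β v with hS
  have hn : nLead α β v = (-X : ℂ[X]) • 1 + S.map C := by
    ext1 i j
    fin_cases i <;> fin_cases j <;> simp [nLead, hS, shiftMat, rc]
  have hv : vLead α β v = (X : ℂ[X]) • 1 + S.map C := by
    ext1 i j
    fin_cases i <;> fin_cases j <;> simp [vLead, hS, shiftMat, rc]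
  have h3 : qPoly • (F - M.map C) =
      (X : ℂ[X]) • (S * M - M * S).map C + (S * M * S - M).map C := by
    rw [smul_sub, h2, hn, hv, neg_X_smul_add_mul_mul, Matrix.map_sub _ (map_sub C),
      Matrix.map_sub _ (map_sub C), Matrix.map_mul, Matrix.map_mul, Matrix.map_mul, Matrix.map_mul,
      qPoly, sub_smul, one_smul]
    abel
  -- A multiple of q that is at most linear in x is zero, so F is the constant M and M commutes with
  -- S.
  have h4 : ∀ i j, (F - M.map C) i j = 0 ∧ (S * M - M * S) i j = 0 := fun i j => by
    refine eq_zero_of_qPoly_mul_eq (b := (S * M * S - M) i j) ?_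
    have := congrFun (congrFun h3 i) j
    rw [mul_comm (C _)]
    exact this
  have hFM : F = M.map C := sub_eq_zero.1 (Matrix.ext fun i j => (h4 i j).1)
  have hSM : S * M = M * S := sub_eq_zero.1 (Matrix.ext fun i j => (h4 i j).2)
  subst hFM
  have hG := first_order_coeff_eq_zero hM' hcomm
  have hv0 : (v : ℂ) ≠ 0 := by exact_mod_cast h.ne_zero
  have hMe : (M.map C : MatPoly (Fin 2)) =
      !![C (M 0 0), C (M 0 1); C (M 1 0), C (M 1 1)] := by
    ext1 i j
    fin_cases i <;> fin_cases j <;> rfl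
  rw [hMe] at hG
  -- An off-diagonal entry of the first-order coefficient has x-coefficient ±v M i j; the difference
  -- of its values at 0 and 1 isolates it.
  have hoff : ∀ i j : Fin 2, i ≠ j → M i j = 0 := by
    intro i j hij
    have e := congrFun (congrFun hG i) j
    have e0 := congrArg (eval 0) e
    have e1 := congrArg (eval 1) e
    have : (v : ℂ) * M i j = 0 := by
      fin_cases i <;> fin_cases j
      · exact absurd rfl hij
      · simp [vLead, nLead, vConst, nConst, rPoly, rc] at e0 e1 ⊢
        exact Or.inr (mul_left_cancel₀ hv0 (by linear_combination e0 - e1))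
      · simp [vLead, nLead, vConst, nConst, rPoly, rc] at e0 e1 ⊢
        exact Or.inr (mul_left_cancel₀ hv0 (by linear_combination e1 - e0))
      · exact absurd rfl hij
    exact (mul_eq_zero.1 this).resolve_left hv0
  -- Now M is diagonal, and it commutes with S, whose entry S 0 1 = (v + β - α)/v is nonzero.
  have hdiag : M 0 0 = M 1 1 := by
    have e := congrFun (congrFun hSM 0) 1
    have hs : S 0 1 ≠ 0 := by
      have : (v + β - α) / v ≠ 0 := by
        refine div_ne_zero ?_ h.ne_zero
        have := h.sub_ne
        intro h0
        exact this (by linarith)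
      have e2 : (1 + (β - α) / v : ℝ) ≠ 0 := by
        have h0 := h.ne_zero
        have : 1 + (β - α) / v = (v + β - α) / v := by field_simp; ring
        rwa [this]
      change ((1 + (β - α) / v : ℝ) : ℂ) ≠ 0
      exact_mod_cast e2
    rw [Matrix.mul_apply, Matrix.mul_apply, Fin.sum_univ_two, Fin.sum_univ_two,
      hoff 0 1 (by decide), mul_zero, zero_mul, zero_add, add_zero, mul_comm] at e
    exact (mul_right_cancel₀ hs e).symm
  refine ⟨M 0 0, ?_⟩
  have hM1 : M = M 0 0 • 1 := by
    ext1 i j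
    by_cases hij : i = j
    · subst hij
      fin_cases i <;> simp [hdiag]
    · simp [hij, hoff i j hij]
  have hM2 : (M.map C : MatPoly (Fin 2)) = M 0 0 • 1 := by
    conv_lhs => rw [hM1]
    rw [map_smul_one]
    ext1 i j
    simp [smul_eq_C_mul]
  rw [hM2, mulBy_smul, mulBy_one]

/-- With t_l the l-th entry of T, inserting 𝒱𝒩 = δ - T gives (𝒩E_il𝒱)(𝒩E_ll δ^k 𝒱) = 𝒩E_il δ^(k+1) 𝒱
- t_l 𝒩E_il δ^k 𝒱, which raises the power of δ by one. -/
lemma generator_mem (k : ℕ) (i l : Fin 2) :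
    jacobiN α β v * mulBy (Matrix.single i l 1) * jacobiOp α β ^ k * jacobiV α β v ∈
      Algebra.adjoin ℂ ({1, jacobiD α β v 0 0, jacobiD α β v 0 1, jacobiD α β v 1 0,
        jacobiD α β v 1 1} : Set (RightOp (Fin 2))) := by
  have hgen : ∀ i l : Fin 2, jacobiD α β v i l ∈
      Algebra.adjoin ℂ ({1, jacobiD α β v 0 0, jacobiD α β v 0 1, jacobiD α β v 1 0,
        jacobiD α β v 1 1} : Set (RightOp (Fin 2))) := by
    intro i l
    refine Algebra.subset_adjoin ?_
    fin_cases i <;> fin_cases l <;> simp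
  induction k generalizing i l with
  | zero =>
    rw [pow_zero, mul_one]
    exact hgen i l
  | succ k ih =>
    have h1 := mul_mem (hgen i l) (ih l l)
    have h2 := Subalgebra.smul_mem _ (ih i l) ((jacobiShift α β v l : ℝ) : ℂ)
    convert add_mem h1 h2 using 1
    have e1 : (Matrix.diagonal fun i => rc (jacobiShift α β v i)) * Matrix.single l l 1 =
        ((jacobiShift α β v l : ℝ) : ℂ) • (Matrix.single l l 1 : MatPoly (Fin 2)) := by
      ext1 a b
      by_cases ha : l = a
      · subst ha
        simp [Matrix.single_apply, rc, smul_eq_C_mul]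
      · simp [ha]
    have e2 : mulBy (Matrix.single i l 1 : MatPoly (Fin 2)) *
        (jacobiV α β v * jacobiN α β v) * mulBy (Matrix.single l l 1) =
        mulBy (Matrix.single i l 1) * jacobiOp α β -
          ((jacobiShift α β v l : ℝ) : ℂ) • mulBy (Matrix.single i l 1) := by
      have hc : mulBy (Matrix.single l l 1 : MatPoly (Fin 2)) * jacobiOp α β =
          jacobiOp α β * mulBy (Matrix.single l l 1) := by
        rw [single_eq_map]
        exact (commute_mulBy_const_jacobiOp α β _).eq
      rw [jacobiV_mul_jacobiN h.ne_zero, mul_assoc, sub_mul, mulBy_mul, e1, mulBy_smul, ← hc,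
        mul_sub, ← mul_assoc, mulBy_mul, mul_smul_comm, mulBy_mul,
        Matrix.single_mul_single_same, one_mul]
    have e3 : jacobiD α β v i l *
        (jacobiN α β v * mulBy (Matrix.single l l 1) * jacobiOp α β ^ k * jacobiV α β v) =
        jacobiN α β v * (mulBy (Matrix.single i l 1) * (jacobiV α β v * jacobiN α β v) *
          mulBy (Matrix.single l l 1)) * jacobiOp α β ^ k * jacobiV α β v := by
      rw [jacobiD]
      simp only [mul_assoc]
    rw [e3, e2, mul_sub, sub_mul, sub_mul, mul_smul_comm, smul_mul_assoc, smul_mul_assoc,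
      sub_add_cancel, pow_succ' _ k]
    simp only [mul_assoc]

lemma constGenerator_mem (k : ℕ) (M : Matrix (Fin 2) (Fin 2) ℂ) :
    jacobiN α β v * mulBy (M.map C) * jacobiOp α β ^ k * jacobiV α β v ∈
      Algebra.adjoin ℂ ({1, jacobiD α β v 0 0, jacobiD α β v 0 1, jacobiD α β v 1 0,
        jacobiD α β v 1 1} : Set (RightOp (Fin 2))) := by
  rw [matMap_eq_sum_single]
  simp only [mulBy_add, mulBy_smul, mul_add, add_mul, mul_smul_comm, smul_mul_assoc]
  refine add_mem (add_mem (add_mem ?_ ?_) ?_) ?_ <;>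
    exact Subalgebra.smul_mem _ (h.generator_mem k _ _) _

/-- Induction on the order: odd leading coefficients vanish, and positive even ones are removed by
subtracting 𝒩Mδ^l𝒱, which itself lies in 𝒟(W). Order zero has no such operator and needs the
separate scalar argument. -/
lemma mem_adjoin {m : ℕ} {D : RightOp (Fin 2)} (hm : D ∈ orderLT (Fin 2) m)
    (hD : D ∈ opAlgebra (Set.Ioo (-1 : ℝ) 1) (jacobiWeight α β v)) :
    D ∈ Algebra.adjoin ℂ ({1, jacobiD α β v 0 0, jacobiD α β v 0 1, jacobiD α β v 1 0,
      jacobiD α β v 1 1} : Set (RightOp (Fin 2))) := by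
  induction m generalizing D with
  | zero =>
    rw [orderLT_zero hm]
    exact zero_mem _
  | succ m ih =>
    obtain ⟨G, hG⟩ := exists_hasTop hm
    by_cases hev : Even m
    · obtain ⟨l, rfl⟩ := hev.two_dvd
      rcases l with _ | l
      · have e : D = mulBy G := by
          have := orderLT_zero hG
          simpa [sub_eq_zero] using this
        subst e
        obtain ⟨z, hz⟩ := h.eq_smul_one_of_mulBy_mem hD
        rw [hz]
        exact Subalgebra.smul_mem _ (one_mem _) z
      · obtain ⟨M, hM⟩ := ((hasTop_vdn hG).leading_of_commute (h.commute_of_mem hD)).1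
          (by simp [Nat.even_add])
        -- The two extra orders from 𝒱 and 𝒩 give the exponent l + 2; cancelling q² afterwards
        -- leaves the q^l of δ^l.
        have e1 : (2 * (l + 1) + 2) / 2 = l + 2 := by omega
        rw [e1] at hM
        have h1 := qPoly_smul_of_vLead_mul h.ne_zero hM
        have hGeq : G = qPoly ^ l • (nLead α β v * M.map C * vLead α β v) := by
          refine qPoly_smul_cancel (k := 2) ?_
          rw [h1, smul_smul, ← pow_add, add_comm 2 l]
          simp
        have hE : HasTop (jacobiN α β v * mulBy (M.map C) * jacobiOp α β ^ l * jacobiV α β v)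
            (2 * (l + 1)) G := by
          have := (((hasTop_firstOrder (nLead α β v) (nConst α β v)).mul
            (hasTop_mulBy (M.map C))).mul (hasTop_jacobiOp_pow α β l)).mul
            (hasTop_firstOrder (vLead α β v) (vConst α β v))
          have e2 : 1 + 0 + 2 * l + 1 = 2 * (l + 1) := by ring
          have e3 : nLead α β v * M.map C * (qPoly ^ l • 1) * vLead α β v = G := by
            rw [hGeq]
            simp
          rw [e2, e3] at this
          exact this
        have hEmem := h.constGenerator_mem l M
        have h2 := hG.sub hE
        rw [sub_self] at h2
        have h3 := ih h2.mem_of_zero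
          ((opSubalgebra (Set.Ioo (-1 : ℝ) 1) (jacobiWeight α β v)).sub_mem hD
            (h.adjoin_le hEmem))
        simpa using add_mem h3 hEmem
    · have h0 := h.even_of_hasTop hD hG hev
      subst h0
      exact ih hG.mem_of_zero hD

end JacobiParams

end

theorem theorem7p3 (α β v : ℝ) (hv₁ : |α - β| < |v|) (hv₂ : |v| < α + β + 2) :
    -- the explicit form of the four operators
    (jacobiD α β v 0 0 =
      del (Fin 2) ^ 2 * mulBy
        !![-X ^ 2 + rc ((α - β) ^ 2 / v ^ 2),
           (rc v * X + rc (α - β)) * rc ((-v + α - β) / v ^ 2);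
           (rc v * X - rc (α - β)) * rc ((v - β + α) / v ^ 2),
           rc (1 - (α - β) ^ 2 / v ^ 2)]
      + del (Fin 2) * mulBy
        !![-X * rc (α + β + 4) - rc ((v - 2) * (α - β) / v),
           rc ((-v + α - β) * (α + β - v + 6) / (2 * v));
           rc ((v - β + α) * (v + 2 + α + β) / (2 * v)),
           0]
      + mulBy
        !![rc (-((-v + 4 + α + β) * (v + 2 + α + β) / 4)), 0;
           0, 0]) ∧
    (jacobiD α β v 0 1 =
      del (Fin 2) ^ 2 * mulBy
        !![(rc v * X + rc (α - β)) * rc ((-v + β - α) / v ^ 2),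
           -((rc v * X + rc (α - β)) ^ 2 * rc (1 / v ^ 2));
           rc ((v - β + α) ^ 2 / v ^ 2),
           (rc v * X + rc (α - β)) * rc ((v - β + α) / v ^ 2)]
      + del (Fin 2) * mulBy
        !![rc ((-v + β - α) * (α + β - v + 6) / (2 * v)),
           -(rc ((-v + 4 + α + β) / v) * (rc v * X + rc (α - β)));
           0,
           rc ((v - β + α) * (-v + 2 + α + β) / (2 * v))]
      + mulBy
        !![0, rc (-((-v + 4 + α + β) * (-v + 2 + α + β) / 4));
           0, 0]) ∧
    (jacobiD α β v 1 0 =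
      del (Fin 2) ^ 2 * mulBy
        !![(-(rc v * X) + rc (α - β)) * rc ((-v + α - β) / v ^ 2),
           rc ((-v + α - β) ^ 2 / v ^ 2);
           -((-(rc v * X) + rc (α - β)) ^ 2 * rc (1 / v ^ 2)),
           (-(rc v * X) + rc (α - β)) * rc ((v - α + β) / v ^ 2)]
      + del (Fin 2) * mulBy
        !![rc (-((v + 2 + α + β) * (-v + α - β) / (2 * v))),
           0;
           rc ((α + β + v + 4) / v) * (-(rc v * X) + rc (α - β)),
           rc ((α + β + v + 6) * (-v + α - β) / (2 * v))]
      + mulBy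
        !![0, 0;
           rc (-((α + β + v + 4) * (v + 2 + α + β) / 4)), 0]) ∧
    (jacobiD α β v 1 1 =
      del (Fin 2) ^ 2 * mulBy
        !![rc (1 - (α - β) ^ 2 / v ^ 2),
           (rc v * X + rc (α - β)) * rc ((v + β - α) / v ^ 2);
           (-(rc v * X) + rc (α - β)) * rc ((v - β + α) / v ^ 2),
           -X ^ 2 + rc ((α - β) ^ 2 / v ^ 2)]
      + del (Fin 2) * mulBy
        !![0,
           rc ((v - α + β) * (-v + 2 + α + β) / (2 * v));
           rc (-((v - β + α) * (α + β + v + 6) / (2 * v))),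
           -X * rc (α + β + 4) - rc ((v + 2) * (α - β) / v)]
      + mulBy
        !![0, 0;
           0, rc (-((α + β + v + 4) * (-v + 2 + α + β) / 4))]) ∧
    -- they are of second order
    (∀ i j : Fin 2, HasOrder (jacobiD α β v i j) 2) ∧
    -- together with `I` they generate the whole algebra `𝒟(W)`
    (Algebra.adjoin ℂ
        ({1, jacobiD α β v 0 0, jacobiD α β v 0 1, jacobiD α β v 1 0, jacobiD α β v 1 1} :
          Set (RightOp (Fin 2))) : Set (RightOp (Fin 2))) =
      opAlgebra (Set.Ioo (-1 : ℝ) 1) (jacobiWeight α β v) ∧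
    -- every nonzero element of `𝒟(W)` has even order
    (∀ D ∈ opAlgebra (Set.Ioo (-1 : ℝ) 1) (jacobiWeight α β v), ∀ m : ℕ,
      HasOrder D m → Even m) := by
  have h : JacobiParams α β v := ⟨hv₁, hv₂⟩
  refine ⟨jacobiD_zero_zero h.ne_zero, jacobiD_zero_one h.ne_zero, jacobiD_one_zero h.ne_zero,
    jacobiD_one_one h.ne_zero, hasOrder_jacobiD h.ne_zero, ?_, ?_⟩
  · refine Set.Subset.antisymm (fun D hD => h.adjoin_le hD) fun D hD => ?_
    obtain ⟨k, hk⟩ := mem_matOmega_iff.1 hD.1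
    exact h.mem_adjoin hk hD
  · rintro D hD m ⟨F, rfl, hF⟩
    by_contra hm
    exact hF (h.even_of_hasTop hD (hasTop_diffOp m F) hm)
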